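/- Let $n_1,n_2,\dots\ge 1$ be integers, $N_0=0$ and $N_t=n_1+\cdots+n_t$, and let $S(n_1,\dots,n_t)$ be the set of permutations (arrangements in a row) of the multiset with $n_i$ copies of $i$, $1\le i\le t$. Every multiset permutation $\pi$ is uniquely an intercalation product of cycles $(x_{1,1}\ldots x_{1,m_1}\,y_1)\perp\cdots\perp(x_{r,1}\ldots x_{r,m_r}\,y_r)$ with $m_i\ge 0$, $y_1\le\cdots\le y_r$ and $y_i<x_{i,j}$ for all $i,j$; here the cycle $(x_1\ldots x_m)$ is the multiset permutation whose two-line notation is obtained by stably sorting the columns $\binom{x_1}{x_2},\dots,\binom{x_{m-1}}{x_m},\binom{x_m}{x_1}$ by their top entries, and $\perp$ juxtaposes two-line notations and stably sorts the columns by their top entries. The number of cycles of $\pi$ is $r$. For $\theta>0$ the multiset Chinese restaurant process is the Markov chain $\tilde\Pi_0=\emptyset,\tilde\Pi_1,\tilde\Pi_2,\dots$ with $\tilde\Pi_t\in S(n_1,\dots,n_t)$ in which, at step $t$, each particular way of placing the $n_t$ copies of $t$ so that $k$ of them ($0\le k\le n_t$) form new singleton cycles and the other $n_t-k$ are inserted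 to the left of letters in the cycles of $\tilde\Pi_{t-1}$ has probability $\theta^k/F_t(\theta)$, where $F_t(\theta)=\sum_{k=0}^{n_t}\binom{N_{t-1}-1+n_t-k}{n_t-k}\theta^k$, with the conventions $\binom{-1}{0}=1$ and $\binom{m-1}{m}=0$ for $m\ge 1$. Let $K_t$ be the number of cycles of $\tilde\Pi_t$. Theorem. Take $\theta=1$, and suppose that there is a constant $C$ with $n_t\le C N_{t-1}$ for all $t\ge 2$ and that $\sum_{t=2}^\infty n_t/N_{t-1}=\infty$ (so $n_t$ may be unbounded). Then, as $t\to\infty$, $$\frac{K_t}{\mathbb E K_t}\to 1\ \text{ almost surely}\qquad\text{and}\qquad \frac{K_t-\mathbb E K_t}{\sqrt{\operatorname{Var}(K_t)}}\ \xrightarrow{d}\ \mathrm N(0,1).$$ -/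

import Mathlib

open MeasureTheory ProbabilityTheory Filter Topology

namespace MultisetCRP

/-! Multiset permutations are words `w : List ℕ` in the letters `1, 2, …`. -/

/-- The two-line notation of a word, as the list of its columns `(top, bottom)`. -/
def twoLine (w : List ℕ) : List (ℕ × ℕ) := (w.insertionSort (· ≤ ·)).zip w

/-- Sort a list of columns stably into nondecreasing order of the top line. -/
def stableSort (L : List (ℕ × ℕ)) : List (ℕ × ℕ) :=
  L.insertionSort (fun p q => p.1 ≤ q.1)

/-- The intercalation product of two multiset permutations. -/
def intercalation (w v : List ℕ) : List ℕ :=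
  (stableSort (twoLine w ++ twoLine v)).map Prod.snd

/-- The multiset permutation denoted by the cycle `(x₁ x₂ … xₘ)`: stably sort the columns
`(x₁, x₂), (x₂, x₃), …, (xₘ, x₁)`. -/
def cycle (x : List ℕ) : List ℕ := (stableSort (x.zip (x.rotate 1))).map Prod.snd

/-- The word `x₁ … xₘ y` of a cycle that is given as the pair `([x₁, …, xₘ], y)`. -/
def cycleWord (p : List ℕ × ℕ) : List ℕ := p.1 ++ [p.2]

/-- The intercalation product of a list of cycles. -/
def cycleProd (c : List (List ℕ × ℕ)) : List ℕ :=
  (c.map fun p => cycle (cycleWord p)).foldr intercalation []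

/-- `c` is a cycle factorisation of the word `w`:
`w = (x₁₁ … y₁) ⊥ (x₂₁ … y₂) ⊥ ⋯` with `y₁ ≤ y₂ ≤ ⋯` and `yᵢ < xᵢⱼ`. -/
structure IsCycleFactorisation (w : List ℕ) (c : List (List ℕ × ℕ)) : Prop where
  prod_eq : cycleProd c = w
  sorted : (c.map Prod.snd).Pairwise (· ≤ ·)
  lt : ∀ p ∈ c, ∀ x ∈ p.1, p.2 < x

/-! Existence and uniqueness of the cycle factorisation. -/

/-- The two lists of columns have, for every top entry, the same columns in the same order. -/
def ColEq (L M : List (ℕ × ℕ)) : Prop :=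
  ∀ a : ℕ, L.filter (fun p => p.1 = a) = M.filter (fun p => p.1 = a)

theorem ColEq.refl (L : List (ℕ × ℕ)) : ColEq L L := fun _ => rfl

theorem ColEq.symm {L M : List (ℕ × ℕ)} (h : ColEq L M) : ColEq M L := fun a => (h a).symm

theorem ColEq.trans {L M K : List (ℕ × ℕ)} (h : ColEq L M) (h' : ColEq M K) : ColEq L K :=
  fun a => (h a).trans (h' a)

theorem ColEq.append {L M L' M' : List (ℕ × ℕ)} (h : ColEq L M) (h' : ColEq L' M') :
    ColEq (L ++ L') (M ++ M') := fun a => by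
  rw [List.filter_append, List.filter_append, h a, h' a]

theorem ColEq.cons {L M : List (ℕ × ℕ)} (p : ℕ × ℕ) (h : ColEq L M) :
    ColEq (p :: L) (p :: M) := ColEq.append (ColEq.refl [p]) h

theorem ColEq.cons_inv {L M : List (ℕ × ℕ)} {v a b : ℕ}
    (h : ColEq ((v, a) :: L) ((v, b) :: M)) : a = b ∧ ColEq L M := by
  have hv := h v
  simp only [List.filter_cons, decide_true, if_true, List.cons.injEq, Prod.mk.injEq,
    true_and] at hv
  refine ⟨hv.1, fun c => ?_⟩
  by_cases hc : v = c
  · subst hc; exact hv.2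
  · simpa [List.filter_cons, hc] using h c

theorem ColEq.perm {L M : List (ℕ × ℕ)} (h : ColEq L M) : L.Perm M := by
  rw [List.perm_iff_count]
  intro p
  have := congrArg (List.count p) (h p.1)
  rwa [List.count_filter (by simp), List.count_filter (by simp)] at this

theorem colEq_orderedInsert (p : ℕ × ℕ) (L : List (ℕ × ℕ)) :
    ColEq (L.orderedInsert (fun p q => p.1 ≤ q.1) p) (p :: L) := by
  induction L with
  | nil => exact ColEq.refl _
  | cons q L ih =>
    rw [List.orderedInsert_cons]
    split_ifs with h
    · exact ColEq.refl _
    · refine (ih.cons q).trans fun a => ?_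
      by_cases h1 : p.1 = a <;> by_cases h2 : q.1 = a <;> simp [h1, h2]
      omega

theorem colEq_stableSort (L : List (ℕ × ℕ)) : ColEq (stableSort L) L := by
  induction L with
  | nil => exact ColEq.refl _
  | cons p L ih =>
    exact (colEq_orderedInsert p _).trans (ih.cons p)

theorem pairwise_stableSort (L : List (ℕ × ℕ)) :
    (stableSort L).Pairwise (fun p q => p.1 ≤ q.1) := by
  have : Std.Total (fun p q : ℕ × ℕ => p.1 ≤ q.1) := ⟨fun p q => le_total p.1 q.1⟩
  have : IsTrans (ℕ × ℕ) (fun p q => p.1 ≤ q.1) := ⟨fun _ _ _ h h' => le_trans h h'⟩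
  exact List.pairwise_insertionSort _ L

theorem ColEq.eq_of_pairwise {L M : List (ℕ × ℕ)} (h : ColEq L M)
    (hL : L.Pairwise (fun p q => p.1 ≤ q.1)) (hM : M.Pairwise (fun p q => p.1 ≤ q.1)) :
    L = M := by
  induction L generalizing M with
  | nil => exact (List.nil_perm.1 h.perm).symm
  | cons p L ih =>
    cases M with
    | nil => exact absurd h.perm (by simp)
    | cons q M =>
      rw [List.pairwise_cons] at hL hM
      have h1 : p.1 ≤ q.1 := by
        rcases List.mem_cons.1 (h.perm.mem_iff.2 List.mem_cons_self) with e | e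
        · rw [e]
        · exact hL.1 _ e
      have h2 : q.1 ≤ p.1 := by
        rcases List.mem_cons.1 (h.perm.mem_iff.1 List.mem_cons_self) with e | e
        · rw [e]
        · exact hM.1 _ e
      obtain ⟨v, a⟩ := p
      obtain ⟨u, b⟩ := q
      obtain rfl : v = u := le_antisymm h1 h2
      obtain ⟨rfl, h'⟩ := h.cons_inv
      rw [ih h' hL.2 hM.2]

theorem map_fst_twoLine (w : List ℕ) : (twoLine w).map Prod.fst = w.insertionSort (· ≤ ·) :=
  List.map_fst_zip (by simp)

theorem map_snd_twoLine (w : List ℕ) : (twoLine w).map Prod.snd = w :=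
  List.map_snd_zip (by simp)

theorem twoLine_balanced (w : List ℕ) :
    ((twoLine w).map Prod.fst).Perm ((twoLine w).map Prod.snd) := by
  rw [map_fst_twoLine, map_snd_twoLine]
  exact List.perm_insertionSort _ _

theorem pairwise_twoLine (w : List ℕ) : (twoLine w).Pairwise (fun p q => p.1 ≤ q.1) := by
  have h := List.pairwise_insertionSort (· ≤ ·) w
  rw [← map_fst_twoLine, List.pairwise_map] at h
  exact h

theorem twoLine_map_snd {L : List (ℕ × ℕ)} (hL : L.Pairwise (fun p q => p.1 ≤ q.1))
    (hb : (L.map Prod.fst).Perm (L.map Prod.snd)) : twoLine (L.map Prod.snd) = L := by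
  have : (L.map Prod.snd).insertionSort (· ≤ ·) = L.map Prod.fst := by
    refine List.Perm.eq_of_pairwise (le := (· ≤ ·)) (fun a b _ _ h h' => le_antisymm h h')
      (List.pairwise_insertionSort _ _) (List.pairwise_map.2 hL) ?_
    exact (List.perm_insertionSort _ _).trans hb.symm
  rw [twoLine, this, List.zip_map', List.map_id'']
  simp

theorem twoLine_map_snd_stableSort {L : List (ℕ × ℕ)}
    (hb : (L.map Prod.fst).Perm (L.map Prod.snd)) :
    ColEq (twoLine ((stableSort L).map Prod.snd)) L := by
  have hp := (colEq_stableSort L).perm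
  rw [twoLine_map_snd (pairwise_stableSort L)
    (((hp.map _).trans hb).trans (hp.map _).symm)]
  exact colEq_stableSort L

/-- The columns `(v, x₁), (x₁, x₂), …, (xₘ, y)`. -/
def path : ℕ → List ℕ → ℕ → List (ℕ × ℕ)
  | v, [], y => [(v, y)]
  | v, a :: x, y => (v, a) :: path a x y

theorem map_fst_path (v : ℕ) (x : List ℕ) (y : ℕ) : (path v x y).map Prod.fst = v :: x := by
  induction x generalizing v with
  | nil => rfl
  | cons a x ih => simp [path, ih]

theorem map_snd_path (v : ℕ) (x : List ℕ) (y : ℕ) :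
    (path v x y).map Prod.snd = x ++ [y] := by
  induction x generalizing v with
  | nil => rfl
  | cons a x ih => simp [path, ih]

theorem path_concat (v : ℕ) (x : List ℕ) (y z : ℕ) :
    path v (x ++ [y]) z = path v x y ++ [(y, z)] := by
  induction x generalizing v with
  | nil => rfl
  | cons a x ih => simp [path, ih]

theorem zip_path (v : ℕ) (x : List ℕ) (y : ℕ) : (v :: x).zip (x ++ [y]) = path v x y := by
  induction x generalizing v with
  | nil => rfl
  | cons a x ih => simp [path, ih]

theorem colEq_rotate (x : List ℕ) (y : ℕ) (h : y ∉ x) :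
    ColEq ((x ++ [y]).zip ((x ++ [y]).rotate 1)) (path y x y) := by
  cases x with
  | nil => simpa [path] using ColEq.refl [(y, y)]
  | cons a x =>
    have e : ((a :: x) ++ [y]).zip (((a :: x) ++ [y]).rotate 1) = path a x y ++ [(y, a)] := by
      rw [← path_concat, List.cons_append, List.rotate_cons_succ, List.rotate_zero, zip_path]
    rw [e]
    intro c
    by_cases hc : y = c
    · subst hc
      have : (path a x y).filter (fun p => p.1 = y) = [] := by
        rw [List.filter_eq_nil_iff]
        intro p hp
        have h' : p.1 ∈ a :: x := map_fst_path a x y ▸ List.mem_map_of_mem hp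
        simp only [decide_eq_true_eq]
        rintro rfl
        exact h h'
      simp [path, List.filter_append, this]
    · simp [path, List.filter_append, hc]

theorem ColEq.path_inv {x x' : List ℕ} {v y : ℕ} {R R' : List (ℕ × ℕ)} (hx : y ∉ x)
    (hx' : y ∉ x') (h : ColEq (path v x y ++ R) (path v x' y ++ R')) :
    x = x' ∧ ColEq R R' := by
  induction x generalizing v x' with
  | nil =>
    cases x' with
    | nil => exact ⟨rfl, h.cons_inv.2⟩
    | cons a' x' => exact absurd h.cons_inv.1 (by rintro rfl; simp at hx')
  | cons a x ih =>
    cases x' with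
    | nil => exact absurd h.cons_inv.1 (by rintro rfl; simp at hx)
    | cons a' x' =>
      obtain ⟨rfl, h'⟩ := h.cons_inv
      obtain ⟨rfl, h''⟩ := ih (by simp_all) (by simp_all) h'
      exact ⟨rfl, h''⟩

/-- All columns of the cycles of `c`. -/
def columns (c : List (List ℕ × ℕ)) : List (ℕ × ℕ) := c.flatMap fun p => path p.2 p.1 p.2

theorem twoLine_cycleProd {c : List (List ℕ × ℕ)} (hc : ∀ p ∈ c, ∀ x ∈ p.1, p.2 < x) :
    ColEq (twoLine (cycleProd c)) (columns c) := by
  induction c with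
  | nil => exact ColEq.refl _
  | cons p c ih =>
    have ih' := ih fun q hq => hc q (List.mem_cons_of_mem _ hq)
    have hp : p.2 ∉ p.1 := fun h => lt_irrefl _ (hc p List.mem_cons_self _ h)
    have e : ColEq (twoLine (cycle (cycleWord p))) (path p.2 p.1 p.2) := by
      refine (twoLine_map_snd_stableSort ?_).trans (colEq_rotate _ _ hp)
      rw [List.map_fst_zip (by simp), List.map_snd_zip (by simp)]
      exact (List.rotate_perm _ _).symm
    refine (twoLine_map_snd_stableSort ?_).trans (e.append ih')
    rw [List.map_append, List.map_append]
    exact (twoLine_balanced _).append (twoLine_balanced _)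

theorem cycleProd_eq_iff {w : List ℕ} {c : List (List ℕ × ℕ)}
    (hc : ∀ p ∈ c, ∀ x ∈ p.1, p.2 < x) :
    cycleProd c = w ↔ ColEq (columns c) (twoLine w) := by
  constructor
  · rintro rfl
    exact (twoLine_cycleProd hc).symm
  · intro h
    have := ((twoLine_cycleProd hc).trans h).eq_of_pairwise (pairwise_twoLine _)
      (pairwise_twoLine _)
    rw [← map_snd_twoLine (cycleProd c), this, map_snd_twoLine]

theorem exists_snd_le {c : List (List ℕ × ℕ)} (hc : ∀ p ∈ c, ∀ x ∈ p.1, p.2 < x) {v : ℕ}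
    (hv : v ∈ (columns c).map Prod.fst) : ∃ p ∈ c, p.2 ≤ v := by
  simp only [columns, List.map_flatMap, map_fst_path, List.mem_flatMap, List.mem_cons] at hv
  obtain ⟨p, hp, h | h⟩ := hv
  · exact ⟨p, hp, h.ge⟩
  · exact ⟨p, hp, (hc p hp v h).le⟩

theorem columns_injective {c c' : List (List ℕ × ℕ)} (hs : (c.map Prod.snd).Pairwise (· ≤ ·))
    (hs' : (c'.map Prod.snd).Pairwise (· ≤ ·)) (hc : ∀ p ∈ c, ∀ x ∈ p.1, p.2 < x)
    (hc' : ∀ p ∈ c', ∀ x ∈ p.1, p.2 < x) (h : ColEq (columns c) (columns c')) : c = c' := by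
  have key : ∀ {p q : List ℕ × ℕ} {c c' : List (List ℕ × ℕ)},
      ((q :: c').map Prod.snd).Pairwise (· ≤ ·) → (∀ p ∈ q :: c', ∀ x ∈ p.1, p.2 < x) →
      ColEq (columns (p :: c)) (columns (q :: c')) → q.2 ≤ p.2 := by
    intro p q c c' hs' hc' h
    have hm : p.2 ∈ (columns (p :: c)).map Prod.fst := by
      simp [columns, map_fst_path]
    obtain ⟨r, hr, hle⟩ := exists_snd_le hc' ((h.perm.map _).mem_iff.1 hm)
    rcases List.mem_cons.1 hr with rfl | hr
    · exact hle
    · rw [List.map_cons, List.pairwise_cons] at hs'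
      exact (hs'.1 _ (List.mem_map_of_mem hr)).trans hle
  induction c generalizing c' with
  | nil =>
    cases c' with
    | nil => rfl
    | cons q c' =>
      have := (h.perm.map Prod.fst).length_eq
      simp [columns, map_fst_path] at this
  | cons p c ih =>
    cases c' with
    | nil =>
      have := (h.perm.map Prod.fst).length_eq
      simp [columns, map_fst_path] at this
    | cons q c' =>
      obtain ⟨x, y⟩ := p
      obtain ⟨x', y'⟩ := q
      obtain rfl : y = y' := le_antisymm (key hs hc h.symm) (key hs' hc' h)
      have hy : y ∉ x := fun h => lt_irrefl _ (hc (x, y) List.mem_cons_self _ h)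
      have hy' : y ∉ x' := fun h => lt_irrefl _ (hc' (x', y) List.mem_cons_self _ h)
      obtain ⟨rfl, h'⟩ := ColEq.path_inv hy hy' h
      rw [ih (List.pairwise_cons.1 hs).2 (List.pairwise_cons.1 hs').2
        (fun p hp => hc p (List.mem_cons_of_mem _ hp))
        (fun p hp => hc' p (List.mem_cons_of_mem _ hp)) h']

theorem exists_pop {L : List (ℕ × ℕ)} {v : ℕ} (hv : v ∈ L.map Prod.fst) :
    ∃ a M, ColEq L ((v, a) :: M) := by
  induction L with
  | nil => simp at hv
  | cons p L ih =>
    by_cases hp : p.1 = v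
    · subst hp
      exact ⟨p.2, L, ColEq.refl _⟩
    · obtain ⟨a, M, h⟩ := ih (by simpa [Ne.symm hp] using hv)
      refine ⟨a, p :: M, (h.cons p).trans fun c => ?_⟩
      by_cases h1 : p.1 = c <;> by_cases h2 : v = c <;> simp [h1, h2]
      exact absurd (h1.trans h2.symm) hp

theorem exists_path (n : ℕ) {L : List (ℕ × ℕ)} {v y : ℕ} (hn : L.length = n)
    (hb : (y :: L.map Prod.fst).Perm (v :: L.map Prod.snd)) (hv : v ≠ y) :
    ∃ x R, ColEq L (path v x y ++ R) ∧ y ∉ x ∧ (R.map Prod.fst).Perm (R.map Prod.snd) := by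
  induction n generalizing L v with
  | zero =>
    obtain rfl := List.length_eq_zero_iff.1 hn
    simp at hb
    exact absurd hb.symm hv
  | succ n ih =>
    have hm : v ∈ L.map Prod.fst := by
      have := hb.mem_iff.2 (List.mem_cons_self (a := v))
      simpa [hv] using this
    obtain ⟨a, M, h⟩ := exists_pop hm
    have h1 := h.perm.map Prod.fst
    have h2 := h.perm.map Prod.snd
    simp only [List.map_cons] at h1 h2
    have hb' : (y :: M.map Prod.fst).Perm (a :: M.map Prod.snd) := by
      have h3 := ((h1.cons y).symm.trans hb).trans (h2.cons v)
      exact ((List.Perm.swap y v _).trans h3).cons_inv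
    by_cases ha : a = y
    · subst ha
      exact ⟨[], M, h, by simp, hb'.cons_inv⟩
    · have hl := h.perm.length_eq
      obtain ⟨x, R, hR, hy, hRb⟩ := ih (L := M) (by simp at hl; omega) hb' ha
      exact ⟨a :: x, R, h.trans (hR.cons _), by simp [Ne.symm ha, hy], hRb⟩

theorem exists_columns (n : ℕ) {L : List (ℕ × ℕ)} (hn : L.length = n)
    (hb : (L.map Prod.fst).Perm (L.map Prod.snd)) :
    ∃ c : List (List ℕ × ℕ), ColEq (columns c) L ∧ (c.map Prod.snd).Pairwise (· ≤ ·) ∧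
      ∀ p ∈ c, ∀ x ∈ p.1, p.2 < x := by
  induction n using Nat.strong_induction_on generalizing L with
  | _ n ih =>
    by_cases h0 : L = []
    · subst h0
      exact ⟨[], ColEq.refl _, by simp, by simp⟩
    have hex : ∃ y, y ∈ L.map Prod.fst := by
      obtain ⟨p, hp⟩ := List.exists_mem_of_ne_nil L h0
      exact ⟨p.1, List.mem_map_of_mem hp⟩
    classical
    let y := Nat.find hex
    have hy : y ∈ L.map Prod.fst := Nat.find_spec hex
    have hmin : ∀ z ∈ L.map Prod.fst, y ≤ z := fun z hz => Nat.find_min' hex hz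
    have main : ∃ x R, ColEq L (path y x y ++ R) ∧ y ∉ x ∧
        (R.map Prod.fst).Perm (R.map Prod.snd) := by
      obtain ⟨a, M, h⟩ := exists_pop hy
      have h1 := h.perm.map Prod.fst
      have h2 := h.perm.map Prod.snd
      simp only [List.map_cons] at h1 h2
      have hb' : (y :: M.map Prod.fst).Perm (a :: M.map Prod.snd) :=
        (h1.symm.trans hb).trans h2
      by_cases ha : a = y
      · rw [ha] at h hb'
        exact ⟨[], M, h, by simp, hb'.cons_inv⟩
      · obtain ⟨x, R, hR, hx, hRb⟩ := exists_path _ rfl hb' ha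
        exact ⟨a :: x, R, h.trans (hR.cons _), by simp [Ne.symm ha, hx], hRb⟩
    obtain ⟨x, R, hR, hx, hRb⟩ := main
    have hperm := hR.perm.map Prod.fst
    rw [List.map_append, map_fst_path] at hperm
    have hlen : R.length < n := by
      have := hperm.length_eq
      simp at this
      omega
    obtain ⟨c, hc, hs, hlt⟩ := ih _ hlen rfl hRb
    refine ⟨(x, y) :: c, (((ColEq.refl (path y x y)).append hc).trans hR.symm), ?_, ?_⟩
    · rw [List.map_cons, List.pairwise_cons]
      refine ⟨fun z hz => hmin z ?_, hs⟩
      rw [hperm.mem_iff, List.mem_append]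
      right
      rw [← (hc.perm.map Prod.fst).mem_iff]
      obtain ⟨p, hp, rfl⟩ := List.mem_map.1 hz
      simp only [columns, List.map_flatMap, map_fst_path, List.mem_flatMap]
      exact ⟨p, hp, List.mem_cons_self⟩
    · intro p hp z hz
      rcases List.mem_cons.1 hp with rfl | hp
      · refine lt_of_le_of_ne (hmin z ?_) ?_
        · rw [hperm.mem_iff]
          simp only [List.cons_append, List.mem_cons, List.mem_append]
          exact Or.inr (Or.inl hz)
        · intro e
          apply hx
          have e' : y = z := e
          rw [e']
          exact hz
      · exact hlt p hp z hz

/-- Every word has exactly one cycle factorisation. -/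
theorem existsUnique_isCycleFactorisation (w : List ℕ) : ∃! c, IsCycleFactorisation w c := by
  obtain ⟨c, hc, hs, hlt⟩ := exists_columns _ rfl (twoLine_balanced w)
  refine ⟨c, ⟨(cycleProd_eq_iff hlt).2 hc, hs, hlt⟩, fun c' h => ?_⟩
  exact columns_injective h.sorted hs h.lt hlt
    (((cycleProd_eq_iff h.lt).1 h.prod_eq).trans hc.symm)

/-- The cycle factorisation of a word. -/
noncomputable def cycles (w : List ℕ) : List (List ℕ × ℕ) :=
  (existsUnique_isCycleFactorisation w).choose

theorem isCycleFactorisation_cycles (w : List ℕ) : IsCycleFactorisation w (cycles w) :=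
  (existsUnique_isCycleFactorisation w).choose_spec.1

/-- The number of cycles `|w|`. -/
noncomputable def numCycles (w : List ℕ) : ℕ := (cycles w).length

/-! The Chinese restaurant process. Only the values `n 1, n 2, …` of a sequence `n` are used. -/

/-- `N_t = n_1 + ⋯ + n_t`. -/
def total (n : ℕ → ℕ) (t : ℕ) : ℕ := ∑ i ∈ Finset.Icc 1 t, n i

/-- The set `S(n_1, …, n_t)` of permutations of the multiset with `n_i` copies of `i`,
`1 ≤ i ≤ t`. -/
def MultisetPerm (n : ℕ → ℕ) (t : ℕ) : Type :=
  {w : List ℕ // (w : Multiset ℕ) = ∑ i ∈ Finset.Icc 1 t, Multiset.replicate (n i) i}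

/-- `InsertLeft a x x'`: the word `x'` arises from `x` by inserting copies of `a`, each to the
left of some letter of `x`. -/
inductive InsertLeft (a : ℕ) : List ℕ → List ℕ → Prop
  | nil : InsertLeft a [] []
  | cons (j b : ℕ) {x x' : List ℕ} (h : InsertLeft a x x') :
      InsertLeft a (b :: x) (List.replicate j a ++ b :: x')

/-- `IsExtension t m k c c'`: the list of cycles `c'` arises from `c` by placing `m` copies of
`t`, of which `k` form new singleton cycles and the others are inserted to the left of letters
in the cycles of `c`. -/
def IsExtension (t m k : ℕ) (c c' : List (List ℕ × ℕ)) : Prop :=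
  ∃ d : List (List ℕ × ℕ),
    List.Forall₂ (fun p q => InsertLeft t (cycleWord p) (cycleWord q)) c d ∧
    c' = d ++ List.replicate k ([], t) ∧
    (c'.flatMap cycleWord).count t = m

/-- `F_t(θ) = ∑_{k=0}^{n_t} binom(N_{t-1} - 1 + n_t - k, n_t - k) θ^k`; the binomial coefficient
is the number of multisets of size `n_t - k` in a set of size `N_{t-1}`. -/
noncomputable def weight (n : ℕ → ℕ) (θ : ℝ) (t : ℕ) : ℝ :=
  ∑ k ∈ Finset.range (n t + 1), (Nat.multichoose (total n (t - 1)) (n t - k) : ℝ) * θ ^ k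

open Classical in
/-- The probability that step `t` of the process leads from `w` to `w'`: it is `θ ^ k / F_t(θ)`
if `w'` extends `w` with `k` new singleton cycles, and `0` if `w'` does not extend `w`. At most
one term of the sum is nonzero. -/
noncomputable def transProb (n : ℕ → ℕ) (θ : ℝ) (t : ℕ) (w w' : List ℕ) : ℝ :=
  ∑ k ∈ Finset.range (n t + 1),
    if IsExtension t (n t) k (cycles w) (cycles w') then θ ^ k / weight n θ t else 0

/-- `π` is a Chinese restaurant process on the permutations of the multisets with multiplicities
`n_1, n_2, …` and with parameter `θ`: the Markov chain, starting at the empty permutation, with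
the above transition probabilities. -/
structure IsMultisetCRP {Ω : Type*} [MeasurableSpace Ω] (P : Measure Ω) (n : ℕ → ℕ) (θ : ℝ)
    (π : (t : ℕ) → Ω → MultisetPerm n t) : Prop where
  measurableSet_eq : ∀ (t : ℕ) (w : MultisetPerm n t), MeasurableSet {ω | π t ω = w}
  law : ∀ (t : ℕ) (w : (s : ℕ) → MultisetPerm n s),
    P.real {ω | ∀ s ≤ t, π s ω = w s} =
      ∏ s ∈ Finset.range t, transProb n θ (s + 1) (w s).1 (w (s + 1)).1

/-- The number `K_t` of cycles at step `t`. -/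
noncomputable def cycleCount {Ω : Type*} {n : ℕ → ℕ} (π : (t : ℕ) → Ω → MultisetPerm n t)
    (t : ℕ) (ω : Ω) : ℝ := (numCycles (π t ω).1 : ℝ)

end MultisetCRP

/-!
For `θ = 1` all ways of placing the copies of `t` are equally likely. The number of new cycles of
step `t` is therefore independent of the past, and it is distributed like the number of balls that
fall into a distinguished box when `n_t` indistinguishable balls are put into `N_{t-1} + 1` boxes
(a Bose–Einstein law), whose factorial moments are explicit. Under `n_t ≤ C N_{t-1}` its variance
is bounded by a constant times its mean, so that Chebyshev's inequality along a subsequence and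
monotonicity give the strong law, and its third absolute central moment is bounded by a constant
times its variance, which is Lyapunov's condition for the central limit theorem.
-/

section StrongLaw

theorem tendsto_div_of_monotone_of_subseq {K a : ℕ → ℝ} {T : ℕ → ℕ} {ℓ : ℝ} (hK : Monotone K)
    (hK0 : 0 ≤ K 0) (ha : Monotone a) (haT : ∀ k, 0 < a (T k)) (hT : Tendsto T atTop atTop)
    (hratio : Tendsto (fun k => a (T (k + 1)) / a (T k)) atTop (𝓝 1))
    (hlim : Tendsto (fun k => K (T k) / a (T k)) atTop (𝓝 ℓ)) :
    Tendsto (fun t => K t / a t) atTop (𝓝 ℓ) := by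
  have hex (t : ℕ) : ∃ k, t < T (k + 1) :=
    (((tendsto_add_atTop_iff_nat 1).2 hT).eventually_gt_atTop t).exists
  let κ (t : ℕ) : ℕ := Nat.find (hex t)
  have hlt (t : ℕ) : t < T (κ t + 1) := Nat.find_spec (hex t)
  have hle {t : ℕ} (ht : 0 < κ t) : T (κ t) ≤ t := by
    obtain ⟨k, hk⟩ := Nat.exists_eq_add_one_of_ne_zero ht.ne'
    rw [hk]
    exact not_lt.1 (Nat.find_min (hex t) (show k < κ t by lia))
  have hκ : Tendsto κ atTop atTop := tendsto_atTop.2 fun N => by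
    have : ∀ᶠ t in atTop, ∀ k ∈ Finset.range N, T (k + 1) ≤ t :=
      (Finset.range N).eventually_all.2 fun k _ => eventually_ge_atTop _
    filter_upwards [this] with t ht
    by_contra! hN
    exact (ht _ (Finset.mem_range.2 hN)).not_gt (hlt t)
  have hlower : Tendsto (fun k => K (T k) / a (T (k + 1))) atTop (𝓝 ℓ) := by
    simpa only [Pi.div_def, div_div_div_cancel_right₀ (haT _).ne', div_one]
      using hlim.div hratio one_ne_zero
  have hupper : Tendsto (fun k => K (T (k + 1)) / a (T k)) atTop (𝓝 ℓ) := by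
    simpa only [div_mul_div_cancel₀ (haT _).ne', mul_one]
      using ((tendsto_add_atTop_iff_nat 1).2 hlim).mul hratio
  refine tendsto_of_tendsto_of_tendsto_of_le_of_le' (hlower.comp hκ) (hupper.comp hκ) ?_ ?_
  all_goals
    filter_upwards [hκ.eventually_gt_atTop 0] with t ht
    have hat : 0 < a t := (haT _).trans_le (ha (hle ht))
    have hKt : 0 ≤ K t := hK0.trans (hK t.zero_le)
  · exact div_le_div₀ hKt (hK (hle ht)) hat (ha (hlt t).le)
  · exact div_le_div₀ (hK0.trans (hK (Nat.zero_le _))) (hK (hlt t).le) (haT _) (ha (hle ht))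

theorem exists_mem_Icc_of_le_add {a : ℕ → ℝ} {B x : ℝ} (hstep : ∀ t, a (t + 1) ≤ a t + B)
    (htop : Tendsto a atTop atTop) (hx : 0 ≤ x) :
    ∃ t, a t ∈ Set.Icc x (x + max (a 0) B) := by
  have hex : ∃ t, x ≤ a t := (htop.eventually_ge_atTop x).exists
  refine ⟨Nat.find hex, Nat.find_spec hex, ?_⟩
  rcases h : Nat.find hex with _ | t
  · linarith [le_max_left (a 0) B]
  · have hlt : a t < x := not_le.1 (Nat.find_min hex (by lia))
    linarith [hstep t, le_max_right (a 0) B]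

theorem ae_tendsto_zero_of_summable_integral_sq {Ω : Type*} [MeasurableSpace Ω] {P : Measure Ω}
    {S : ℕ → Ω → ℝ} {c : ℕ → ℝ} (hS : ∀ k, MemLp (S k) 2 P)
    (hle : ∀ k, ∫ ω, S k ω ^ 2 ∂P ≤ c k) (hc : Summable c) :
    ∀ᵐ ω ∂P, Tendsto (fun k => S k ω) atTop (𝓝 0) := by
  have hmeas (k : ℕ) : AEMeasurable (fun ω => ENNReal.ofReal (S k ω ^ 2)) P :=
    ((hS k).aestronglyMeasurable.aemeasurable.pow_const 2).ennreal_ofReal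
  have hfin : ∫⁻ ω, ∑' k, ENNReal.ofReal (S k ω ^ 2) ∂P ≠ ⊤ := by
    rw [lintegral_tsum hmeas]
    refine ne_top_of_le_ne_top hc.tsum_ofReal_ne_top (ENNReal.tsum_le_tsum fun k => ?_)
    rw [← ofReal_integral_eq_lintegral_ofReal (hS k).integrable_sq
      (.of_forall fun _ => sq_nonneg _)]
    exact ENNReal.ofReal_le_ofReal (hle k)
  filter_upwards [ae_lt_top' (AEMeasurable.tsum hmeas) hfin] with ω hω
  have hsq : Tendsto (fun k => S k ω ^ 2) atTop (𝓝 0) := by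
    simpa only [Function.comp_def, ENNReal.toReal_ofReal (sq_nonneg _), ENNReal.toReal_zero]
      using (ENNReal.tendsto_toReal ENNReal.zero_ne_top).comp
        (ENNReal.tendsto_atTop_zero_of_tsum_ne_top hω.ne)
  exact (tendsto_zero_iff_abs_tendsto_zero _).2
    (by simpa only [Function.comp_def, Real.sqrt_sq_eq_abs, Real.sqrt_zero] using hsq.sqrt)

theorem tendsto_succ_div_of_mem_Icc_sq {x : ℕ → ℝ} {B : ℝ}
    (hx : ∀ k : ℕ, x k ∈ Set.Icc (((k : ℝ) + 1) ^ 2) (((k : ℝ) + 1) ^ 2 + B)) :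
    Tendsto (fun k => x (k + 1) / x k) atTop (𝓝 1) := by
  have hinv : Tendsto (fun k : ℕ => 1 / ((k : ℝ) + 1)) atTop (𝓝 0) :=
    tendsto_one_div_add_atTop_nhds_zero_nat
  have hsq : Tendsto (fun k : ℕ => x k / ((k : ℝ) + 1) ^ 2) atTop (𝓝 1) := by
    have hup : Tendsto (fun k : ℕ => 1 + B * (1 / ((k : ℝ) + 1)) ^ 2) atTop (𝓝 1) := by
      simpa using ((hinv.pow 2).const_mul B).const_add 1
    refine tendsto_of_tendsto_of_tendsto_of_le_of_le tendsto_const_nhds hup (fun k => ?_)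
      fun k => ?_
    · exact (one_le_div₀ (by positivity)).2 (hx k).1
    · refine (div_le_iff₀ (by positivity)).2 ((hx k).2.trans_eq ?_)
      field_simp
  have hratio : Tendsto (fun k : ℕ => (1 + 1 / ((k : ℝ) + 1)) ^ 2) atTop (𝓝 1) := by
    simpa using (hinv.const_add (1 : ℝ)).pow 2
  have hmul := (((tendsto_add_atTop_iff_nat 1).2 hsq).div hsq one_ne_zero).mul hratio
  rw [div_one, mul_one] at hmul
  refine hmul.congr fun k => ?_
  have hxk : x k ≠ 0 := (lt_of_lt_of_le (by positivity) (hx k).1).ne'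
  simp only [Pi.div_apply]
  push_cast
  field_simp

theorem ae_tendsto_div_integral_of_variance_le {Ω : Type*} [MeasurableSpace Ω] {P : Measure Ω}
    [IsProbabilityMeasure P] {K : ℕ → Ω → ℝ} {A B : ℝ} (hK : ∀ t, MemLp (K t) 2 P)
    (hmono : ∀ᵐ ω ∂P, Monotone fun t => K t ω) (hK0 : ∀ᵐ ω ∂P, 0 ≤ K 0 ω)
    (hvar : ∀ t, Var[K t; P] ≤ A * P[K t]) (hstep : ∀ t, P[K (t + 1)] ≤ P[K t] + B)
    (htop : Tendsto (fun t => P[K t]) atTop atTop) :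
    ∀ᵐ ω ∂P, Tendsto (fun t => K t ω / P[K t]) atTop (𝓝 1) := by
  have hmean : Monotone fun t => P[K t] := fun s t hst =>
    integral_mono_ae ((hK s).integrable one_le_two) ((hK t).integrable one_le_two)
      (hmono.mono fun ω hω => hω hst)
  choose T hT using fun k : ℕ =>
    exists_mem_Icc_of_le_add hstep htop (sq_nonneg ((k : ℝ) + 1))
  have hTpos (k : ℕ) : 0 < P[K (T k)] := lt_of_lt_of_le (by positivity) (hT k).1
  have hTtop : Tendsto T atTop atTop := by
    have hle (k : ℕ) : (k : ℝ) ≤ P[K (T k)] := by nlinarith [(hT k).1, k.cast_nonneg (α := ℝ)]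
    refine tendsto_atTop.2 fun N => ?_
    filter_upwards [tendsto_natCast_atTop_atTop.eventually_gt_atTop P[K N]] with k hk
    exact (hmean.reflect_lt (hk.trans_le (hle k))).le
  have hA : 0 ≤ A :=
    nonneg_of_mul_nonneg_left ((variance_nonneg _ _).trans (hvar (T 0))) (hTpos 0)
  have hdev : ∀ᵐ ω ∂P, Tendsto (fun k => (K (T k) ω - P[K (T k)]) / P[K (T k)]) atTop (𝓝 0) := by
    refine ae_tendsto_zero_of_summable_integral_sq (c := fun k : ℕ => A * (1 / ((k : ℝ) + 1) ^ 2))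
      (fun k => ?_) (fun k => ?_) ?_
    · simpa only [div_eq_inv_mul, Pi.sub_apply] using
        ((hK (T k)).sub (memLp_const _)).const_mul P[K (T k)]⁻¹
    · calc ∫ ω, ((K (T k) ω - P[K (T k)]) / P[K (T k)]) ^ 2 ∂P
          = Var[K (T k); P] / P[K (T k)] ^ 2 := by
            simp only [div_pow, integral_div, variance_eq_integral (hK _).aemeasurable]
        _ ≤ A * P[K (T k)] / P[K (T k)] ^ 2 := by gcongr; exact hvar _
        _ = A * (1 / P[K (T k)]) := by have := (hTpos k).ne'; field_simp
        _ ≤ A * (1 / ((k : ℝ) + 1) ^ 2) := by gcongr; exact (hT k).1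
    · exact .mul_left _ (by
        simpa only [Nat.cast_succ] using
          (summable_nat_add_iff 1).2 (Real.summable_one_div_nat_pow.2 one_lt_two))
  filter_upwards [hdev, hmono, hK0] with ω hω hm h0
  refine tendsto_div_of_monotone_of_subseq hm h0 hmean hTpos hTtop
    (tendsto_succ_div_of_mem_Icc_sq hT) ?_
  simpa only [sub_div, div_self (hTpos _).ne', sub_add_cancel, zero_add] using hω.add_const 1

end StrongLaw

section LyapunovCLT

theorem norm_cexp_mul_I_sub_le (x : ℝ) :
    ‖Complex.exp (x * Complex.I) - (1 + x * Complex.I - x ^ 2 / 2)‖ ≤ 4 * |x| ^ 3 := by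
  have hnorm : ‖(x : ℂ) * Complex.I‖ = |x| := by simp
  rcases le_or_gt |x| 1 with hx | hx
  · have hsum : ∑ m ∈ Finset.range 3, ((x : ℂ) * Complex.I) ^ m / (m.factorial : ℂ) =
        1 + x * Complex.I - x ^ 2 / 2 := by
      simp only [Finset.sum_range_succ, Finset.sum_range_zero, mul_pow, Complex.I_sq]
      norm_num
      ring
    have hexp := Complex.exp_bound (hnorm.trans_le hx) (n := 3) (by norm_num)
    rw [hsum, hnorm] at hexp
    refine hexp.trans ?_
    norm_num [Nat.factorial]
    linarith [pow_nonneg (abs_nonneg x) 3]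
  · have hx1 : |x| ≤ |x| ^ 3 := le_self_pow₀ hx.le (by norm_num)
    have hx2 : |x| ^ 2 ≤ |x| ^ 3 := pow_le_pow_right₀ hx.le (by norm_num)
    calc ‖Complex.exp (x * Complex.I) - (1 + x * Complex.I - x ^ 2 / 2)‖
        ≤ ‖Complex.exp (x * Complex.I)‖ + (‖(1 : ℂ)‖ + ‖x * Complex.I‖ + ‖(x : ℂ) ^ 2 / 2‖) :=
          (norm_sub_le _ _).trans (add_le_add_right ((norm_sub_le _ _).trans
            (add_le_add_left (norm_add_le _ _) _)) _)
      _ = 1 + (1 + |x| + |x| ^ 2 / 2) := by rw [Complex.norm_exp_ofReal_mul_I, hnorm]; simp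
      _ ≤ 4 * |x| ^ 3 := by linarith

theorem abs_exp_neg_sq_div_two_sub_le {s : ℝ} (hs : 0 ≤ s) :
    |Real.exp (-(s ^ 2 / 2)) - (1 - s ^ 2 / 2)| ≤ s ^ 3 := by
  rcases le_or_gt s 1 with h1 | h1
  · have hy : ‖-(s ^ 2 / 2)‖ ≤ 1 := by
      rw [norm_neg, Real.norm_of_nonneg (by positivity)]
      nlinarith
    calc |Real.exp (-(s ^ 2 / 2)) - (1 - s ^ 2 / 2)|
        = ‖Real.exp (-(s ^ 2 / 2)) - 1 - -(s ^ 2 / 2)‖ := by rw [Real.norm_eq_abs]; ring_nf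
      _ ≤ ‖-(s ^ 2 / 2)‖ ^ 2 := Real.norm_exp_sub_one_sub_id_le hy
      _ = s ^ 3 * (s / 4) := by rw [norm_neg, Real.norm_of_nonneg (by positivity)]; ring
      _ ≤ s ^ 3 := mul_le_of_le_one_right (by positivity) (by linarith)
  · have hle : Real.exp (-(s ^ 2 / 2)) ≤ 1 := Real.exp_le_one_iff.2 (by nlinarith)
    rw [abs_of_nonneg (by linarith [Real.add_one_le_exp (-(s ^ 2 / 2))])]
    nlinarith [pow_le_pow_right₀ h1.le (show 2 ≤ 3 by norm_num)]

theorem norm_prod_sub_prod_le {ι R : Type*} [NormedCommRing R] [NormOneClass R] (s : Finset ι)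
    {a b : ι → R} (ha : ∀ i ∈ s, ‖a i‖ ≤ 1) (hb : ∀ i ∈ s, ‖b i‖ ≤ 1) :
    ‖∏ i ∈ s, a i - ∏ i ∈ s, b i‖ ≤ ∑ i ∈ s, ‖a i - b i‖ := by
  classical
  induction s using Finset.induction_on with
  | empty => simp
  | insert i s hi ih =>
    rw [Finset.forall_mem_insert] at ha hb
    have hprod : ‖∏ j ∈ s, a j‖ ≤ 1 :=
      (Finset.norm_prod_le s a).trans (Finset.prod_le_one (fun _ _ => norm_nonneg _) ha.2)
    rw [Finset.prod_insert hi, Finset.prod_insert hi, Finset.sum_insert hi]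
    calc ‖a i * ∏ j ∈ s, a j - b i * ∏ j ∈ s, b j‖
        = ‖(a i - b i) * ∏ j ∈ s, a j + b i * (∏ j ∈ s, a j - ∏ j ∈ s, b j)‖ := by ring_nf
      _ ≤ ‖a i - b i‖ * ‖∏ j ∈ s, a j‖ + ‖b i‖ * ‖∏ j ∈ s, a j - ∏ j ∈ s, b j‖ :=
        (norm_add_le _ _).trans (add_le_add (norm_mul_le _ _) (norm_mul_le _ _))
      _ ≤ ‖a i - b i‖ + ∑ j ∈ s, ‖a j - b j‖ :=
        add_le_add (mul_le_of_le_one_right (norm_nonneg _) hprod)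
          ((mul_le_of_le_one_left (norm_nonneg _) hb.1).trans (ih ha.2 hb.2))

variable {Ω : Type*} [MeasurableSpace Ω] {P : Measure Ω}

theorem integrable_abs_pow_three {Y : Ω → ℝ} (hY : MemLp Y 3 P) :
    Integrable (fun ω => |Y ω| ^ 3) P :=
  hY.integrable_norm_pow (p := 3) (by norm_num)

theorem variance_sum_of_iIndepFun {ι : Type*} {X : ι → Ω → ℝ} (hind : iIndepFun X P)
    (hX : ∀ i, MemLp (X i) 2 P) (s : Finset ι) :
    Var[fun ω => ∑ i ∈ s, X i ω; P] = ∑ i ∈ s, Var[X i; P] := by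
  rw [← IndepFun.variance_sum (fun i _ => hX i) fun i _ j _ hij => hind.indepFun hij,
    Finset.sum_fn]

variable [IsProbabilityMeasure P]

theorem sqrt_integral_sq_pow_three_le {Y : Ω → ℝ} (hY : MemLp Y 3 P) :
    √(∫ ω, Y ω ^ 2 ∂P) ^ 3 ≤ ∫ ω, |Y ω| ^ 3 ∂P := by
  set σ := √(∫ ω, Y ω ^ 2 ∂P)
  have hσ : σ ^ 2 = ∫ ω, Y ω ^ 2 ∂P := Real.sq_sqrt (integral_nonneg fun _ => sq_nonneg _)
  have hσ0 : 0 ≤ σ := Real.sqrt_nonneg _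
  have hY2 : Integrable (fun ω => Y ω ^ 2) P := (hY.mono_exponent (by norm_num)).integrable_sq
  have hY3 := integrable_abs_pow_three hY
  have young (x : ℝ) : 3 * σ * x ^ 2 ≤ 2 * |x| ^ 3 + σ ^ 3 := by
    rw [← sq_abs]
    nlinarith [mul_nonneg (add_nonneg (mul_nonneg zero_le_two (abs_nonneg x)) hσ0)
      (sq_nonneg (|x| - σ))]
  have hint : 3 * σ * ∫ ω, Y ω ^ 2 ∂P ≤ 2 * (∫ ω, |Y ω| ^ 3 ∂P) + σ ^ 3 := by
    calc 3 * σ * ∫ ω, Y ω ^ 2 ∂P = ∫ ω, 3 * σ * Y ω ^ 2 ∂P := (integral_const_mul _ _).symm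
      _ ≤ ∫ ω, (2 * |Y ω| ^ 3 + σ ^ 3) ∂P :=
        integral_mono (hY2.const_mul _) ((hY3.const_mul 2).add (integrable_const _))
          fun ω => young (Y ω)
      _ = 2 * (∫ ω, |Y ω| ^ 3 ∂P) + σ ^ 3 := by
        rw [integral_add (hY3.const_mul 2) (integrable_const _), integral_const_mul]
        simp
  rw [← hσ] at hint
  linarith

theorem norm_integral_cexp_mul_I_sub_le {Y : Ω → ℝ} (hY : MemLp Y 3 P) (h0 : P[Y] = 0) :
    ‖∫ ω, Complex.exp (Y ω * Complex.I) ∂P - (1 - (∫ ω, Y ω ^ 2 ∂P) / 2 : ℝ)‖ ≤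
      4 * ∫ ω, |Y ω| ^ 3 ∂P := by
  have hY2 : MemLp Y 2 P := hY.mono_exponent (by norm_num)
  have hexp : Integrable (fun ω => Complex.exp (Y ω * Complex.I)) P :=
    .of_bound (by have := hY.aemeasurable; fun_prop) 1
      (.of_forall fun ω => (Complex.norm_exp_ofReal_mul_I _).le)
  have hlin : Integrable (fun ω => (Y ω : ℂ) * Complex.I) P :=
    (hY2.integrable one_le_two).ofReal.mul_const _
  have hlin1 : Integrable (fun ω => 1 + (Y ω : ℂ) * Complex.I) P := (integrable_const _).add hlin
  have hquad : Integrable (fun ω => (Y ω : ℂ) ^ 2 / 2) P := by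
    simpa using (hY2.integrable_sq.ofReal (𝕜 := ℂ)).div_const 2
  have hpoly : Integrable (fun ω => 1 + (Y ω : ℂ) * Complex.I - (Y ω : ℂ) ^ 2 / 2) P :=
    hlin1.sub hquad
  have htaylor : ∫ ω, (1 + Y ω * Complex.I - (Y ω : ℂ) ^ 2 / 2) ∂P =
      ((1 - (∫ ω, Y ω ^ 2 ∂P) / 2 : ℝ) : ℂ) := by
    rw [integral_sub hlin1 hquad, integral_add (integrable_const _) hlin, integral_mul_const,
      integral_complex_ofReal, h0, integral_div]
    simp [← Complex.ofReal_pow, integral_complex_ofReal]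
  rw [← htaylor, ← integral_sub hexp hpoly, ← integral_const_mul]
  exact norm_integral_le_of_norm_le ((integrable_abs_pow_three hY).const_mul _)
    (.of_forall fun ω => norm_cexp_mul_I_sub_le (Y ω))

theorem norm_integral_cexp_mul_I_sub_exp_le {Y : Ω → ℝ} (hY : MemLp Y 3 P) (h0 : P[Y] = 0) :
    ‖∫ ω, Complex.exp (Y ω * Complex.I) ∂P - Real.exp (-((∫ ω, Y ω ^ 2 ∂P) / 2))‖ ≤
      5 * ∫ ω, |Y ω| ^ 3 ∂P := by
  have hσ : √(∫ ω, Y ω ^ 2 ∂P) ^ 2 = ∫ ω, Y ω ^ 2 ∂P :=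
    Real.sq_sqrt (integral_nonneg fun _ => sq_nonneg _)
  have hgauss : ‖((1 - (∫ ω, Y ω ^ 2 ∂P) / 2 : ℝ) : ℂ) - Real.exp (-((∫ ω, Y ω ^ 2 ∂P) / 2))‖ ≤
      ∫ ω, |Y ω| ^ 3 ∂P := by
    rw [← Complex.ofReal_sub, Complex.norm_real, Real.norm_eq_abs, abs_sub_comm, ← hσ]
    exact (abs_exp_neg_sq_div_two_sub_le (Real.sqrt_nonneg _)).trans
      (sqrt_integral_sq_pow_three_le hY)
  linarith [norm_sub_le_norm_sub_add_norm_sub (∫ ω, Complex.exp (Y ω * Complex.I) ∂P)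
    ((1 - (∫ ω, Y ω ^ 2 ∂P) / 2 : ℝ) : ℂ) (Real.exp (-((∫ ω, Y ω ^ 2 ∂P) / 2))),
    norm_integral_cexp_mul_I_sub_le hY h0]

theorem norm_charFun_map_sub_exp_le {Y : Ω → ℝ} (hY : MemLp Y 3 P) (h0 : P[Y] = 0) (u : ℝ) :
    ‖charFun (P.map Y) u - Real.exp (-(u ^ 2 * (∫ ω, Y ω ^ 2 ∂P) / 2))‖ ≤
      5 * |u| ^ 3 * ∫ ω, |Y ω| ^ 3 ∂P := by
  have hmean : ∫ ω, u * Y ω ∂P = 0 := by rw [integral_const_mul, h0, mul_zero]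
  have hbound := norm_integral_cexp_mul_I_sub_exp_le (hY.const_mul u) hmean
  rw [charFun_apply_real, integral_map hY.aemeasurable (by fun_prop)]
  simpa only [Complex.ofReal_mul, abs_mul, mul_pow, integral_const_mul, mul_assoc] using hbound

theorem norm_charFun_map_sum_sub_exp_le {ι : Type*} {Y : ι → Ω → ℝ} {s : Finset ι}
    (hind : iIndepFun (s.restrict Y) P) (hY : ∀ i ∈ s, MemLp (Y i) 3 P)
    (h0 : ∀ i ∈ s, P[Y i] = 0) (u : ℝ) :
    ‖charFun (P.map fun ω => ∑ i ∈ s, Y i ω) u -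
      Real.exp (-(u ^ 2 * (∑ i ∈ s, ∫ ω, Y i ω ^ 2 ∂P) / 2))‖ ≤
      5 * |u| ^ 3 * ∑ i ∈ s, ∫ ω, |Y i ω| ^ 3 ∂P := by
  have hexp : ((Real.exp (-(u ^ 2 * (∑ i ∈ s, ∫ ω, Y i ω ^ 2 ∂P) / 2)) : ℝ) : ℂ) =
      ∏ i ∈ s, (Real.exp (-(u ^ 2 * (∫ ω, Y i ω ^ 2 ∂P) / 2)) : ℂ) := by
    rw [← Complex.ofReal_prod, ← Real.exp_sum, Finset.sum_neg_distrib, ← Finset.sum_div,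
      Finset.mul_sum]
  have hind' := hind.charFun_map_fun_finsetSum_eq_prod fun i hi => (hY i hi).aemeasurable
  rw [hind', Finset.prod_apply, hexp, Finset.mul_sum]
  refine (norm_prod_sub_prod_le s (fun i hi => ?_) fun i _ => ?_).trans
    (Finset.sum_le_sum fun i hi => norm_charFun_map_sub_exp_le (hY i hi) (h0 i hi) u)
  · have := Measure.isProbabilityMeasure_map (μ := P) (hY i hi).aemeasurable
    exact norm_charFun_le_one u
  · rw [Complex.norm_real, Real.norm_of_nonneg (Real.exp_pos _).le, Real.exp_le_one_iff,
      neg_nonpos]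
    have : 0 ≤ ∫ ω, Y i ω ^ 2 ∂P := integral_nonneg fun _ => sq_nonneg _
    positivity

theorem norm_charFun_map_sum_div_sqrt_sub_exp_le {ι : Type*} {Y : ι → Ω → ℝ} {s : Finset ι}
    (hind : iIndepFun (s.restrict Y) P) (hY : ∀ i ∈ s, MemLp (Y i) 3 P)
    (h0 : ∀ i ∈ s, P[Y i] = 0) (hpos : 0 < ∑ i ∈ s, ∫ ω, Y i ω ^ 2 ∂P) (u : ℝ) :
    ‖charFun (P.map fun ω => (∑ i ∈ s, Y i ω) / √(∑ i ∈ s, ∫ ω, Y i ω ^ 2 ∂P)) u -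
      Real.exp (-(u ^ 2 / 2))‖ ≤
      5 * |u| ^ 3 * ((∑ i ∈ s, ∫ ω, |Y i ω| ^ 3 ∂P) / √(∑ i ∈ s, ∫ ω, Y i ω ^ 2 ∂P) ^ 3) := by
  have hsq := Real.sq_sqrt hpos.le
  have hσ := Real.sqrt_pos.2 hpos
  set σ := √(∑ i ∈ s, ∫ ω, Y i ω ^ 2 ∂P)
  have hbound := norm_charFun_map_sum_sub_exp_le hind hY h0 (σ⁻¹ * u)
  rw [← charFun_map_mul_comp (Finset.aemeasurable_fun_sum _ fun i hi => (hY i hi).aemeasurable),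
    ← hsq, abs_mul, abs_inv, abs_of_pos hσ] at hbound
  convert! hbound using 1
  · congr 3
    · simp only [div_eq_inv_mul]
    · field_simp
  · field_simp

theorem tendstoInDistribution_of_lyapunov {X : ℕ → Ω → ℝ} (hind : iIndepFun X P)
    (hX : ∀ s, MemLp (X s) 3 P) (hpos : ∀ᶠ t in atTop, 0 < ∑ s ∈ Finset.range t, Var[X s; P])
    (hlyap : Tendsto (fun t => (∑ s ∈ Finset.range t, ∫ ω, |X s ω - P[X s]| ^ 3 ∂P) /
      √(∑ s ∈ Finset.range t, Var[X s; P]) ^ 3) atTop (𝓝 0)) :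
    TendstoInDistribution (fun t ω => (∑ s ∈ Finset.range t, (X s ω - P[X s])) /
      √(∑ s ∈ Finset.range t, Var[X s; P])) atTop id (fun _ => P) (gaussianReal 0 1) where
  forall_aemeasurable t := (Finset.aemeasurable_fun_sum _ fun s _ =>
    (hX s).aemeasurable.sub_const _).div_const _
  tendsto := by
    refine ProbabilityMeasure.tendsto_iff_tendsto_charFun.2 fun u => ?_
    let Y (s : ℕ) (ω : Ω) : ℝ := X s ω - P[X s]
    have hY (s : ℕ) : MemLp (Y s) 3 P := (hX s).sub (memLp_const _)
    have hYind : iIndepFun Y P := hind.comp (fun s x => x - ∫ ω, X s ω ∂P) fun s => by fun_prop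
    have hY0 (s : ℕ) : P[Y s] = 0 := by
      simp [Y, integral_sub ((hX s).integrable (by norm_num)) (integrable_const _)]
    have hY2 (s : ℕ) : ∫ ω, Y s ω ^ 2 ∂P = Var[X s; P] :=
      (variance_eq_integral (hX s).aemeasurable).symm
    have hlim : Tendsto (fun t => charFun (P.map fun ω => (∑ s ∈ Finset.range t, Y s ω) /
        √(∑ s ∈ Finset.range t, Var[X s; P])) u) atTop (𝓝 (Real.exp (-(u ^ 2 / 2)))) := by
      rw [tendsto_iff_norm_sub_tendsto_zero]
      refine squeeze_zero' (.of_forall fun _ => norm_nonneg _) ?_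
        (by simpa only [mul_zero] using hlyap.const_mul (5 * |u| ^ 3))
      filter_upwards [hpos] with t ht
      simp only [← hY2] at ht ⊢
      exact norm_charFun_map_sum_div_sqrt_sub_exp_le (hYind.restrict _) (fun s _ => hY s)
        (fun s _ => hY0 s) ht u
    have hgauss : charFun ((gaussianReal 0 1).map id) u = Real.exp (-(u ^ 2 / 2)) := by
      simp [charFun_gaussianReal]
    exact hgauss ▸ hlim

theorem tendstoInDistribution_of_third_moment_le_variance {X : ℕ → Ω → ℝ} (hind : iIndepFun X P)
    (hX : ∀ s, MemLp (X s) 3 P) {c : ℝ}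
    (hthird : ∀ s, ∫ ω, |X s ω - P[X s]| ^ 3 ∂P ≤ c * Var[X s; P])
    (htop : Tendsto (fun t => ∑ s ∈ Finset.range t, Var[X s; P]) atTop atTop) :
    TendstoInDistribution (fun t ω => (∑ s ∈ Finset.range t, X s ω -
      ∫ ω', ∑ s ∈ Finset.range t, X s ω' ∂P) / √(Var[fun ω => ∑ s ∈ Finset.range t, X s ω; P]))
      atTop id (fun _ => P) (gaussianReal 0 1) := by
  have hmean (t : ℕ) : ∫ ω, ∑ s ∈ Finset.range t, X s ω ∂P = ∑ s ∈ Finset.range t, P[X s] :=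
    integral_finsetSum _ fun s _ => (hX s).integrable (by norm_num)
  simp only [hmean, variance_sum_of_iIndepFun hind fun s => (hX s).mono_exponent (by norm_num),
    ← Finset.sum_sub_distrib]
  have hpos := htop.eventually_gt_atTop 0
  refine tendstoInDistribution_of_lyapunov hind hX hpos (squeeze_zero'
    (.of_forall fun t => by positivity) ?_
    ((Real.tendsto_sqrt_atTop.comp htop).const_div_atTop c))
  filter_upwards [hpos] with t ht
  calc (∑ s ∈ Finset.range t, ∫ ω, |X s ω - P[X s]| ^ 3 ∂P) /
        √(∑ s ∈ Finset.range t, Var[X s; P]) ^ 3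
      ≤ c * (∑ s ∈ Finset.range t, Var[X s; P]) / √(∑ s ∈ Finset.range t, Var[X s; P]) ^ 3 := by
        rw [Finset.mul_sum]
        gcongr with s
        exact hthird s
    _ = c / √(∑ s ∈ Finset.range t, Var[X s; P]) := by
        nth_rw 1 [← Real.sq_sqrt ht.le]
        have := (Real.sqrt_pos.2 ht).ne'
        field_simp

end LyapunovCLT

section BoseEinstein

open scoped NNReal

theorem sum_multichoose (N m : ℕ) :
    ∑ k ∈ Finset.range (m + 1), N.multichoose (m - k) = (N + 1).multichoose m := by
  induction m with
  | zero => simp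
  | succ m ih =>
    rw [Finset.sum_range_succ', Nat.multichoose_succ_succ, ← ih, add_comm]
    simp

theorem sum_choose_succ_mul_multichoose (N j m : ℕ) :
    ∑ k ∈ Finset.range (m + 2), k.choose (j + 1) * N.multichoose (m + 1 - k) =
      ∑ k ∈ Finset.range (m + 1), k.choose j * N.multichoose (m - k) +
        ∑ k ∈ Finset.range (m + 1), k.choose (j + 1) * N.multichoose (m - k) := by
  rw [Finset.sum_range_succ']
  simp [Nat.choose_succ_succ, add_mul, Finset.sum_add_distrib]

theorem sum_choose_mul_multichoose (N j r : ℕ) :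
    ∑ k ∈ Finset.range (j + r + 1), k.choose j * N.multichoose (j + r - k) =
      (N + j + 1).multichoose r := by
  induction j generalizing r with
  | zero => simpa using sum_multichoose N r
  | succ j ih =>
    induction r with
    | zero =>
      have hzero : ∑ k ∈ Finset.range (j + 1), k.choose (j + 1) * N.multichoose (j - k) = 0 :=
        Finset.sum_eq_zero fun k hk => by
          rw [Nat.choose_eq_zero_of_lt (Finset.mem_range.1 hk), zero_mul]
      have hprev := ih 0
      rw [add_zero, Nat.multichoose_zero_right] at hprev ⊢
      rw [sum_choose_succ_mul_multichoose, hzero, hprev]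
    | succ r ihr =>
      have hprev := ih (r + 1)
      rw [← add_assoc, Nat.add_right_comm j] at hprev
      rw [← add_assoc, sum_choose_succ_mul_multichoose, ihr, hprev, ← add_assoc N,
        Nat.multichoose_succ_succ (N + j + 1)]

theorem sum_choose_mul_multichoose_mul_choose (N j m : ℕ) :
    (∑ k ∈ Finset.range (m + 1), k.choose j * N.multichoose (m - k)) * (N + j).choose j =
      m.choose j * (N + 1).multichoose m := by
  rcases lt_or_ge m j with hj | hj
  · rw [Nat.choose_eq_zero_of_lt hj, zero_mul, Finset.sum_eq_zero, zero_mul]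
    intro k hk
    rw [Nat.choose_eq_zero_of_lt (by grind), zero_mul]
  · obtain ⟨r, rfl⟩ := Nat.exists_eq_add_of_le hj
    have htrinomial := Nat.choose_mul (n := N + j + r) (k := j + r) (s := r) (by lia)
    rw [sum_choose_mul_multichoose, Nat.multichoose_eq, Nat.multichoose_eq]
    simp only [Nat.add_sub_cancel, Nat.add_right_comm _ 1, ← add_assoc] at htrinomial ⊢
    rw [← htrinomial, mul_comm, Nat.choose_symm_add]

variable (N m : ℕ)

/-- The probability of `k` balls in a given box, when all the ways of placing `m` indistinguishable
balls into `N + 1` boxes are equally likely (Bose–Einstein statistics). This is the law of the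
number of new cycles in a step of the Chinese restaurant process with `θ = 1`. -/
noncomputable def boseEinsteinWeight (k : ℕ) : ℝ≥0 :=
  N.multichoose (m - k) / (N + 1).multichoose m

/-- The Bose–Einstein distribution with the weights `boseEinsteinWeight N m`, as a measure on
`ℝ`. -/
noncomputable def boseEinstein : Measure ℝ :=
  ∑ k ∈ Finset.range (m + 1), boseEinsteinWeight N m k • Measure.dirac (k : ℝ)

theorem sum_boseEinsteinWeight_mul_choose (j : ℕ) :
    ∑ k ∈ Finset.range (m + 1), boseEinsteinWeight N m k * k.choose j =
      m.choose j / (N + j).choose j := by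
  have hm : ((N + 1).multichoose m : ℝ≥0) ≠ 0 := by
    rw [Nat.multichoose_eq, Nat.cast_ne_zero]
    exact (Nat.choose_pos (by lia)).ne'
  have hN : ((N + j).choose j : ℝ≥0) ≠ 0 := by
    exact_mod_cast (Nat.choose_pos (Nat.le_add_left j N)).ne'
  simp only [boseEinsteinWeight, div_mul_eq_mul_div, ← Finset.sum_div]
  rw [div_eq_div_iff hm hN]
  simp only [mul_comm (Nat.cast (N.multichoose _))]
  exact_mod_cast sum_choose_mul_multichoose_mul_choose N j m

instance : IsProbabilityMeasure (boseEinstein N m) where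
  measure_univ := by
    have hsum := sum_boseEinsteinWeight_mul_choose N m 0
    simp only [Nat.choose_zero_right, Nat.cast_one, mul_one, div_one] at hsum
    simp only [boseEinstein, Measure.coe_finsetSum, Finset.sum_apply, Measure.smul_apply,
      measure_univ, ENNReal.smul_def, smul_eq_mul, mul_one]
    exact_mod_cast hsum

theorem integrable_boseEinstein (f : ℝ → ℝ) : Integrable f (boseEinstein N m) :=
  integrable_finsetSum_measure.2 fun _ _ =>
    (integrable_dirac (by simp)).smul_measure ENNReal.coe_ne_top

theorem integral_boseEinstein (f : ℝ → ℝ) :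
    ∫ x, f x ∂boseEinstein N m = ∑ k ∈ Finset.range (m + 1), boseEinsteinWeight N m k * f k := by
  rw [boseEinstein, integral_finsetSum_measure fun _ _ =>
    (integrable_dirac (by simp)).smul_measure ENNReal.coe_ne_top]
  simp [integral_smul_nnreal_measure, NNReal.smul_def]

theorem integral_boseEinstein_of_eq_choose {f : ℝ → ℝ} {j : ℕ} (hf : ∀ k : ℕ, f k = k.choose j) :
    ∫ x, f x ∂boseEinstein N m = m.choose j / (N + j).choose j := by
  have hsum := congrArg NNReal.toReal (sum_boseEinsteinWeight_mul_choose N m j)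
  push_cast at hsum
  simp only [integral_boseEinstein, hf, hsum]

theorem integral_id_boseEinstein : ∫ x, x ∂boseEinstein N m = m / (N + 1) := by
  simpa using integral_boseEinstein_of_eq_choose N m (f := id) (j := 1) (by simp)

theorem ae_mem_Icc_boseEinstein : ∀ᵐ x ∂boseEinstein N m, x ∈ Set.Icc (0 : ℝ) m := by
  rw [boseEinstein, ae_finsetSum_measure_iff]
  refine fun k hk => Measure.ae_smul_measure ((ae_dirac_iff measurableSet_Icc).2 ?_) _
  exact ⟨k.cast_nonneg, Nat.cast_le.2 (Nat.lt_succ_iff.1 (Finset.mem_range.1 hk))⟩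

theorem memLp_id_boseEinstein (p : ENNReal) : MemLp id p (boseEinstein N m) := by
  refine .of_bound aestronglyMeasurable_id m ?_
  filter_upwards [ae_mem_Icc_boseEinstein N m] with x hx
  rw [id_eq, Real.norm_of_nonneg hx.1]
  exact hx.2

theorem variance_id_boseEinstein : Var[id; boseEinstein N m] =
    N / (N + 2) * (m / (N + 1) * (m / (N + 1) + 1)) := by
  have hchoose := integral_boseEinstein_of_eq_choose N m (f := fun x => x * (x - 1) / 2)
    fun k => (Nat.cast_choose_two ℝ k).symm
  have hsq : ∫ x, x ^ 2 ∂boseEinstein N m =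
      2 * (m.choose 2 / (N + 2).choose 2) + m / (N + 1) := by
    rw [← hchoose, ← integral_id_boseEinstein, ← integral_const_mul,
      ← integral_add (integrable_boseEinstein ..) (integrable_boseEinstein ..)]
    congr with x
    ring
  have hN : ((N + 2).choose 2 : ℝ) = (N + 2) * (N + 1) / 2 := by
    rw [Nat.cast_choose_two]
    push_cast
    ring
  rw [variance_eq_sub (memLp_id_boseEinstein N m 2)]
  simp only [Pi.pow_apply, id_eq]
  rw [hsq, integral_id_boseEinstein, hN, Nat.cast_choose_two]
  field_simp
  ring

theorem choose_div_choose_le_pow (j : ℕ) :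
    (m.choose j : ℝ) / (N + j).choose j ≤ (m / (N + 1)) ^ j := by
  have hnum : (m.choose j : ℝ) ≤ m ^ j / j.factorial := Nat.choose_le_pow_div j m
  have hden : ((N : ℝ) + 1) ^ j / j.factorial ≤ (N + j).choose j := by
    have hpow := Nat.pow_le_choose (α := ℝ) j (N + j)
    rwa [Nat.add_right_comm, Nat.add_sub_cancel, Nat.cast_add, Nat.cast_one] at hpow
  calc (m.choose j : ℝ) / (N + j).choose j
      ≤ (m ^ j / j.factorial) / ((N + 1) ^ j / j.factorial) := by gcongr
    _ = (m / (N + 1)) ^ j := by rw [div_div_div_cancel_right₀ (by positivity), div_pow]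

theorem pow_three_eq_choose (k : ℕ) : k ^ 3 = 6 * k.choose 3 + 6 * k.choose 2 + k := by
  induction k with
  | zero => rfl
  | succ k ih =>
    have hsq : k ^ 2 = 2 * k.choose 2 + k := by
      rw [Nat.choose_two_right, Nat.mul_div_cancel' k.even_mul_pred_self.two_dvd]
      cases k with
      | zero => rfl
      | succ k => rw [Nat.add_sub_cancel]; ring
    rw [Nat.choose_succ_succ' k 1, Nat.choose_succ_succ' k 2, Nat.choose_one_right]
    linarith

theorem integral_pow_three_boseEinstein_le : ∫ x, x ^ 3 ∂boseEinstein N m ≤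
    6 * (m / (N + 1)) ^ 3 + 6 * (m / (N + 1)) ^ 2 + m / (N + 1) := by
  have hchoose : ∫ x, x ^ 3 ∂boseEinstein N m = 6 * (m.choose 3 / (N + 3).choose 3) +
      6 * (m.choose 2 / (N + 2).choose 2) + m.choose 1 / (N + 1).choose 1 := by
    have hsum (j : ℕ) := congrArg NNReal.toReal (sum_boseEinsteinWeight_mul_choose N m j)
    push_cast at hsum
    simp only [integral_boseEinstein, ← hsum, Finset.mul_sum, ← Finset.sum_add_distrib]
    refine Finset.sum_congr rfl fun k _ => ?_
    have hcube : (k : ℝ) ^ 3 = 6 * k.choose 3 + 6 * k.choose 2 + k := by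
      exact_mod_cast pow_three_eq_choose k
    rw [hcube, Nat.choose_one_right]
    ring
  rw [hchoose]
  linarith [choose_div_choose_le_pow N m 1, choose_div_choose_le_pow N m 2,
    choose_div_choose_le_pow N m 3]

theorem abs_sub_pow_three_le {x e : ℝ} (hx : 0 ≤ x) (he : 0 ≤ e) :
    |x - e| ^ 3 ≤ x ^ 3 + e ^ 3 := by
  rcases le_total x e with h | h
  · rw [abs_of_nonpos (sub_nonpos.2 h), neg_sub]
    exact (pow_le_pow_left₀ (sub_nonneg.2 h) (sub_le_self e hx) 3).trans
      (le_add_of_nonneg_left (pow_nonneg hx 3))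
  · rw [abs_of_nonneg (sub_nonneg.2 h)]
    exact (pow_le_pow_left₀ (sub_nonneg.2 h) (sub_le_self x he) 3).trans
      (le_add_of_nonneg_right (pow_nonneg he 3))

theorem integral_abs_sub_pow_three_boseEinstein_le :
    ∫ x, |x - m / (N + 1)| ^ 3 ∂boseEinstein N m ≤
      7 * (m / (N + 1)) ^ 3 + 6 * (m / (N + 1)) ^ 2 + m / (N + 1) := by
  have hle : ∫ x, |x - m / (N + 1)| ^ 3 ∂boseEinstein N m ≤
      ∫ x, x ^ 3 + ((m : ℝ) / (N + 1)) ^ 3 ∂boseEinstein N m := by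
    rw [integral_boseEinstein, integral_boseEinstein]
    gcongr with k
    exact abs_sub_pow_three_le k.cast_nonneg (by positivity)
  rw [integral_add (integrable_boseEinstein ..) (integrable_const _), integral_const,
    probReal_univ, one_smul] at hle
  linarith [integral_pow_three_boseEinstein_le N m]

theorem boseEinstein_zero_left : boseEinstein 0 m = Measure.dirac (m : ℝ) := by
  have hzero : ∀ k ∈ Finset.range m, boseEinsteinWeight 0 m k • Measure.dirac (k : ℝ) = 0 := by
    intro k hk
    obtain ⟨r, hr⟩ := Nat.exists_eq_succ_of_ne_zero (Nat.sub_pos_of_lt (Finset.mem_range.1 hk)).ne'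
    rw [boseEinsteinWeight, hr, Nat.multichoose_zero_succ, Nat.cast_zero, zero_div, zero_smul]
  rw [boseEinstein, Finset.sum_range_succ, Finset.sum_eq_zero hzero, zero_add]
  simp [boseEinsteinWeight]

variable {N m}

theorem div_add_one_le_mul_variance_boseEinstein (hN : N ≠ 0) :
    (m : ℝ) / (N + 1) ≤ 3 * Var[id; boseEinstein N m] := by
  have hN1 : (1 : ℝ) ≤ N := by exact_mod_cast Nat.one_le_iff_ne_zero.2 hN
  have hthird : (1 : ℝ) / 3 ≤ N / (N + 2) := by
    rw [div_le_div_iff₀ (by norm_num) (by positivity)]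
    linarith
  have hmean : (0 : ℝ) ≤ m / (N + 1) := by positivity
  rw [variance_id_boseEinstein]
  nlinarith [mul_le_mul_of_nonneg_right hthird (mul_nonneg hmean (add_nonneg hmean zero_le_one))]

theorem div_le_mul_variance_boseEinstein : (m : ℝ) / N ≤ 6 * Var[id; boseEinstein N m] := by
  rcases eq_or_ne N 0 with rfl | hN
  · simp [variance_nonneg]
  · have hN1 : (1 : ℝ) ≤ N := by exact_mod_cast Nat.one_le_iff_ne_zero.2 hN
    have hdouble : (m : ℝ) / N ≤ 2 * (m / (N + 1)) := by
      rw [← mul_div_assoc, div_le_div_iff₀ (by linarith) (by linarith)]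
      nlinarith [m.cast_nonneg (α := ℝ)]
    linarith [div_add_one_le_mul_variance_boseEinstein (m := m) hN]

theorem variance_boseEinstein_le_mul {B : ℝ} (hB : (m : ℝ) / (N + 1) ≤ B) :
    Var[id; boseEinstein N m] ≤ (B + 1) * (m / (N + 1)) := by
  have hfrac : (N : ℝ) / (N + 2) ≤ 1 := by
    rw [div_le_one (by positivity)]
    linarith
  calc Var[id; boseEinstein N m]
      = N / (N + 2) * (m / (N + 1) * (m / (N + 1) + 1)) := variance_id_boseEinstein N m
    _ ≤ m / (N + 1) * (m / (N + 1) + 1) := mul_le_of_le_one_left (by positivity) hfrac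
    _ ≤ (B + 1) * (m / (N + 1)) := by rw [mul_comm]; gcongr

theorem integral_abs_sub_pow_three_boseEinstein_le_mul_variance {B : ℝ}
    (hB : (m : ℝ) / (N + 1) ≤ B) :
    ∫ x, |x - m / (N + 1)| ^ 3 ∂boseEinstein N m ≤
      3 * (7 * B ^ 2 + 6 * B + 1) * Var[id; boseEinstein N m] := by
  rcases eq_or_ne N 0 with rfl | hN
  · simp [boseEinstein_zero_left]
  · have hmean : (0 : ℝ) ≤ m / (N + 1) := by positivity
    have hB0 : 0 ≤ B := hmean.trans hB
    set e : ℝ := m / (N + 1)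
    calc ∫ x, |x - e| ^ 3 ∂boseEinstein N m
        ≤ 7 * e ^ 3 + 6 * e ^ 2 + e := integral_abs_sub_pow_three_boseEinstein_le N m
      _ = (7 * e ^ 2 + 6 * e + 1) * e := by ring
      _ ≤ (7 * B ^ 2 + 6 * B + 1) * (3 * Var[id; boseEinstein N m]) := by
        gcongr
        exact div_add_one_le_mul_variance_boseEinstein hN
      _ = 3 * (7 * B ^ 2 + 6 * B + 1) * Var[id; boseEinstein N m] := by ring

end BoseEinstein

section SumsOfBoseEinstein

variable {Ω : Type*} [MeasurableSpace Ω] {P : Measure Ω}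

section Single

variable {N m : ℕ} {X : Ω → ℝ}

theorem memLp_of_hasLaw_boseEinstein (hX : HasLaw X (boseEinstein N m) P) (p : ENNReal) :
    MemLp X p P :=
  MemLp.comp_of_map (f := X) (g := id) (hX.map_eq ▸ memLp_id_boseEinstein N m p) hX.aemeasurable

theorem ae_nonneg_of_hasLaw_boseEinstein (hX : HasLaw X (boseEinstein N m) P) :
    ∀ᵐ ω ∂P, 0 ≤ X ω :=
  (hX.ae_iff measurableSet_Ici.mem).2 ((ae_mem_Icc_boseEinstein N m).mono fun _ hx => hx.1)

end Single

variable [IsProbabilityMeasure P] {N m : ℕ → ℕ} {X : ℕ → Ω → ℝ} {B : ℝ}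

theorem tendsto_sum_variance_boseEinstein
    (htop : Tendsto (fun t => ∑ s ∈ Finset.range t, (m s : ℝ) / N s) atTop atTop) :
    Tendsto (fun t => ∑ s ∈ Finset.range t, Var[id; boseEinstein (N s) (m s)]) atTop atTop := by
  refine tendsto_atTop_mono (fun t => ?_) (htop.atTop_div_const (r := 6) (by norm_num))
  rw [div_le_iff₀' (by norm_num), Finset.mul_sum]
  exact Finset.sum_le_sum fun s _ => div_le_mul_variance_boseEinstein

theorem ae_tendsto_sum_div_integral_of_hasLaw_boseEinstein (hind : iIndepFun X P)
    (hX : ∀ s, HasLaw (X s) (boseEinstein (N s) (m s)) P) (hB : ∀ s, (m s : ℝ) / (N s + 1) ≤ B)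
    (htop : Tendsto (fun t => ∑ s ∈ Finset.range t, (m s : ℝ) / N s) atTop atTop) :
    ∀ᵐ ω ∂P, Tendsto (fun t => (∑ s ∈ Finset.range t, X s ω) /
      ∫ ω', ∑ s ∈ Finset.range t, X s ω' ∂P) atTop (𝓝 1) := by
  have hmean (t : ℕ) : ∫ ω, ∑ s ∈ Finset.range t, X s ω ∂P =
      ∑ s ∈ Finset.range t, (m s : ℝ) / (N s + 1) := by
    rw [integral_finsetSum _ fun s _ =>
      (memLp_of_hasLaw_boseEinstein (hX s) 1).integrable le_rfl]
    simp only [(hX _).integral_eq, integral_id_boseEinstein]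
  have hvar (t : ℕ) : Var[fun ω => ∑ s ∈ Finset.range t, X s ω; P] =
      ∑ s ∈ Finset.range t, Var[id; boseEinstein (N s) (m s)] := by
    rw [variance_sum_of_iIndepFun hind fun s => memLp_of_hasLaw_boseEinstein (hX s) 2]
    simp only [(hX _).variance_eq]
  have hvar_le (t : ℕ) : ∑ s ∈ Finset.range t, Var[id; boseEinstein (N s) (m s)] ≤
      (B + 1) * ∑ s ∈ Finset.range t, (m s : ℝ) / (N s + 1) := by
    rw [Finset.mul_sum]
    exact Finset.sum_le_sum fun s _ => variance_boseEinstein_le_mul (hB s)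
  have hB0 : 0 ≤ B := (by positivity : (0 : ℝ) ≤ (m 0 : ℝ) / (N 0 + 1)).trans (hB 0)
  refine ae_tendsto_div_integral_of_variance_le (A := B + 1) (B := B)
    (fun t => memLp_finsetSum _ fun s _ => memLp_of_hasLaw_boseEinstein (hX s) 2) ?_ (by simp)
    (fun t => ?_) (fun t => ?_) ?_
  · filter_upwards [ae_all_iff.2 fun s => ae_nonneg_of_hasLaw_boseEinstein (hX s)] with ω hω
    refine monotone_nat_of_le_succ fun t => ?_
    rw [Finset.sum_range_succ]
    exact le_add_of_nonneg_right (hω t)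
  · rw [hvar, hmean]
    exact hvar_le t
  · rw [hmean, hmean, Finset.sum_range_succ]
    gcongr
    exact hB t
  · simp only [hmean]
    exact (tendsto_const_mul_atTop_of_pos (by positivity)).1
      (tendsto_atTop_mono hvar_le (tendsto_sum_variance_boseEinstein htop))

theorem tendstoInDistribution_sum_of_hasLaw_boseEinstein (hind : iIndepFun X P)
    (hX : ∀ s, HasLaw (X s) (boseEinstein (N s) (m s)) P) (hB : ∀ s, (m s : ℝ) / (N s + 1) ≤ B)
    (htop : Tendsto (fun t => ∑ s ∈ Finset.range t, (m s : ℝ) / N s) atTop atTop) :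
    TendstoInDistribution (fun t ω => (∑ s ∈ Finset.range t, X s ω -
      ∫ ω', ∑ s ∈ Finset.range t, X s ω' ∂P) / √(Var[fun ω => ∑ s ∈ Finset.range t, X s ω; P]))
      atTop id (fun _ => P) (gaussianReal 0 1) := by
  refine tendstoInDistribution_of_third_moment_le_variance hind
    (fun s => memLp_of_hasLaw_boseEinstein (hX s) 3) (c := 3 * (7 * B ^ 2 + 6 * B + 1))
    (fun s => ?_) ?_
  · have hcomp := (hX s).integral_comp (f := fun x => |x - m s / (N s + 1)| ^ 3)
      (by fun_prop)
    rw [(hX s).integral_eq, integral_id_boseEinstein, (hX s).variance_eq]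
    exact hcomp.trans_le (integral_abs_sub_pow_three_boseEinstein_le_mul_variance (hB s))
  · simpa only [(hX _).variance_eq] using tendsto_sum_variance_boseEinstein htop

end SumsOfBoseEinstein

namespace MultisetCRP

section InsertLeft

variable {a b : ℕ} {x x' y z : List ℕ}

theorem insertLeft_nil_iff : InsertLeft a [] z ↔ z = [] :=
  ⟨fun h => by cases h; rfl, fun h => by rw [h]; exact .nil⟩

theorem insertLeft_cons_iff :
    InsertLeft a (b :: x) z ↔ ∃ j x', z = List.replicate j a ++ b :: x' ∧ InsertLeft a x x' :=
  ⟨fun h => by cases h with | cons j b h => exact ⟨j, _, rfl, h⟩,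
    fun ⟨j, _, hz, h⟩ => hz ▸ .cons j b h⟩

theorem InsertLeft.cons_self (h : InsertLeft a (b :: x) z) : InsertLeft a (b :: x) (a :: z) := by
  obtain ⟨j, x', rfl, hx⟩ := insertLeft_cons_iff.1 h
  exact .cons (j + 1) b hx

theorem insertLeft_append_iff : InsertLeft a (x ++ y) z ↔
    ∃ x' y', z = x' ++ y' ∧ InsertLeft a x x' ∧ InsertLeft a y y' := by
  induction x generalizing z with
  | nil => simp [insertLeft_nil_iff]
  | cons b x ih =>
    simp only [List.cons_append, insertLeft_cons_iff, ih]
    constructor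
    · rintro ⟨j, _, rfl, x', y', rfl, hx, hy⟩
      exact ⟨List.replicate j a ++ b :: x', y', by simp, ⟨j, x', rfl, hx⟩, hy⟩
    · rintro ⟨_, y', rfl, ⟨j, x', rfl, hx⟩, hy⟩
      exact ⟨j, x' ++ y', by simp, x', y', rfl, hx, hy⟩

theorem InsertLeft.getLast? (h : InsertLeft a x x') : x'.getLast? = x.getLast? := by
  induction h with
  | nil => rfl
  | cons j b _ ih => simp [List.getLast?_append, List.getLast?_cons, ih]

theorem InsertLeft.mem_or_eq (h : InsertLeft a x x') (hb : b ∈ x') : b ∈ x ∨ b = a := by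
  induction h with
  | nil => exact .inl hb
  | cons _ _ _ ih => grind

theorem InsertLeft.filter_ne (h : InsertLeft a x x') (ha : a ∉ x) :
    x'.filter (· ≠ a) = x := by
  induction h with
  | nil => rfl
  | cons j b _ ih =>
    rw [List.mem_cons, not_or] at ha
    simpa [List.filter_cons, Ne.symm ha.1] using ih ha.2

theorem InsertLeft.perm_append_replicate (h : InsertLeft a x x') (ha : a ∉ x) :
    x'.Perm (x ++ List.replicate (x'.count a) a) := by
  have hsplit := List.filter_append_perm (· ≠ a) x'
  rw [h.filter_ne ha] at hsplit
  simpa [List.filter_eq] using hsplit.symm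

theorem InsertLeft.eq_nil_of_append (ha : a ∉ x) (h : InsertLeft a x x')
    (h' : InsertLeft a x (x' ++ y)) : y = [] := by
  have hfilter : y.filter (· ≠ a) = [] := by
    have happend := h'.filter_ne ha
    rwa [List.filter_append, h.filter_ne ha, List.append_right_eq_self] at happend
  have hall : ∀ b ∈ y, b = a := by simpa using hfilter
  by_contra hy
  have hlast : x.getLast? = some a := by
    rw [← h'.getLast?, List.getLast?_append_of_ne_nil _ hy, List.getLast?_eq_some_getLast hy,
      hall _ (List.getLast_mem hy)]
  exact ha (List.mem_of_getLast? hlast)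

theorem InsertLeft.eq_of_append_eq_append {x'' y' : List ℕ} (ha : a ∉ x)
    (h : InsertLeft a x x') (h' : InsertLeft a x x'') (heq : x' ++ y = x'' ++ y') : x' = x'' := by
  rcases List.append_eq_append_iff.1 heq with ⟨e, rfl, -⟩ | ⟨e, rfl, -⟩
  · rw [h.eq_nil_of_append ha h', List.append_nil]
  · rw [h'.eq_nil_of_append ha h, List.append_nil]

/-- The words that arise from `x` by inserting `m` copies of `a`, each to the left of a letter
of `x`. -/
def wordInsertions (a : ℕ) (x : List ℕ) (m : ℕ) : Set (List ℕ) :=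
  {x' | InsertLeft a x x' ∧ x'.count a = m}

theorem wordInsertions_cons_zero (hb : b ≠ a) :
    wordInsertions a (b :: x) 0 = (b :: ·) '' wordInsertions a x 0 := by
  ext z
  simp only [wordInsertions, insertLeft_cons_iff, Set.mem_ofPred_eq, Set.mem_image]
  constructor
  · rintro ⟨⟨_ | j, x', rfl, h⟩, hz⟩
    · exact ⟨x', ⟨h, by simpa [hb] using hz⟩, rfl⟩
    · simp [List.replicate_succ] at hz
  · rintro ⟨x', ⟨h, hz⟩, rfl⟩
    exact ⟨⟨0, x', rfl, h⟩, by simpa [hb] using hz⟩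

theorem wordInsertions_cons_succ (hb : b ≠ a) (m : ℕ) :
    wordInsertions a (b :: x) (m + 1) =
      (b :: ·) '' wordInsertions a x (m + 1) ∪ (a :: ·) '' wordInsertions a (b :: x) m := by
  ext z
  simp only [wordInsertions, Set.mem_ofPred_eq, Set.mem_union, Set.mem_image]
  constructor
  · rintro ⟨h, hz⟩
    obtain ⟨_ | j, x', rfl, hx⟩ := insertLeft_cons_iff.1 h
    · exact .inl ⟨x', ⟨hx, by simpa [hb] using hz⟩, rfl⟩
    · refine .inr ⟨_, ⟨.cons j b hx, ?_⟩, rfl⟩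
      simpa [List.replicate_succ] using hz
  · rintro (⟨x', ⟨h, hz⟩, rfl⟩ | ⟨z, ⟨h, hz⟩, rfl⟩)
    · exact ⟨.cons 0 b h, by simpa [hb] using hz⟩
    · exact ⟨h.cons_self, by simpa using hz⟩

theorem encard_wordInsertions (ha : a ∉ x) (m : ℕ) :
    (wordInsertions a x m).encard = x.length.multichoose m := by
  induction x generalizing m with
  | nil =>
    cases m with
    | zero =>
      have hset : wordInsertions a [] 0 = {[]} := by
        ext z
        simp +contextual [wordInsertions, insertLeft_nil_iff]
      simp [hset]
    | succ m =>
      have hset : wordInsertions a [] (m + 1) = ∅ := by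
        ext z
        simp +contextual [wordInsertions, insertLeft_nil_iff]
      simp [hset]
  | cons b x ih =>
    rw [List.mem_cons, not_or] at ha
    have hb : b ≠ a := Ne.symm ha.1
    induction m with
    | zero =>
      rw [wordInsertions_cons_zero hb, List.cons_injective.encard_image, ih ha.2]
      simp
    | succ m ihm =>
      have hdisj : Disjoint ((b :: ·) '' wordInsertions a x (m + 1))
          ((a :: ·) '' wordInsertions a (b :: x) m) :=
        Set.disjoint_image_image fun _ _ _ _ => by simp [hb]
      rw [wordInsertions_cons_succ hb, Set.encard_union_eq hdisj,
        List.cons_injective.encard_image, List.cons_injective.encard_image, ih ha.2, ihm,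
        List.length_cons, Nat.multichoose_succ_succ, Nat.cast_add]

end InsertLeft

section InsertCycles

variable {a : ℕ} {c d : List (List ℕ × ℕ)}

/-- Insertion of copies of `a` to the left of letters in the cycles of `c`, as in
`IsExtension`. -/
abbrev InsertCycles (a : ℕ) : List (List ℕ × ℕ) → List (List ℕ × ℕ) → Prop :=
  List.Forall₂ fun p q => InsertLeft a (cycleWord p) (cycleWord q)

theorem InsertLeft.exists_of_cycleWord {p : List ℕ × ℕ} {z : List ℕ}
    (h : InsertLeft a (cycleWord p) z) :
    ∃ x', z = cycleWord (x', p.2) ∧ ∀ b ∈ x', b ∈ p.1 ∨ b = a := by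
  obtain ⟨x', _, rfl, hx, hy⟩ := insertLeft_append_iff.1 h
  obtain ⟨j, _, rfl, hnil⟩ := insertLeft_cons_iff.1 hy
  obtain rfl := insertLeft_nil_iff.1 hnil
  refine ⟨x' ++ List.replicate j a, by simp [cycleWord], fun b hb => ?_⟩
  rcases List.mem_append.1 hb with hb | hb
  · exact hx.mem_or_eq hb
  · exact .inr (List.eq_of_mem_replicate hb)

theorem cycleWord_injective : Function.Injective cycleWord := by
  rintro ⟨x, y⟩ ⟨x', y'⟩ h
  simpa [cycleWord] using List.append_inj' h rfl

theorem InsertLeft.snd_eq {p q : List ℕ × ℕ} (h : InsertLeft a (cycleWord p) (cycleWord q)) :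
    q.2 = p.2 := by
  obtain ⟨x', hq, -⟩ := h.exists_of_cycleWord
  rw [cycleWord_injective hq]

theorem InsertLeft.mem_fst_or_eq {p q : List ℕ × ℕ} {b : ℕ}
    (h : InsertLeft a (cycleWord p) (cycleWord q)) (hb : b ∈ q.1) : b ∈ p.1 ∨ b = a := by
  obtain ⟨x', hq, hx'⟩ := h.exists_of_cycleWord
  rw [cycleWord_injective hq] at hb
  exact hx' b hb

theorem InsertCycles.exists_of_mem (h : InsertCycles a c d) {q : List ℕ × ℕ} (hq : q ∈ d) :
    ∃ p ∈ c, InsertLeft a (cycleWord p) (cycleWord q) := by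
  induction h with
  | nil => simp at hq
  | cons h _ ih => grind

theorem InsertCycles.map_snd (h : InsertCycles a c d) : d.map Prod.snd = c.map Prod.snd := by
  induction h with
  | nil => rfl
  | cons h _ ih => rw [List.map_cons, List.map_cons, h.snd_eq, ih]

theorem insertLeft_flatMap_cycleWord_iff {z : List ℕ} :
    InsertLeft a (c.flatMap cycleWord) z ↔
      ∃ d, InsertCycles a c d ∧ d.flatMap cycleWord = z := by
  induction c generalizing z with
  | nil => simp [insertLeft_nil_iff, eq_comm]
  | cons p c ih =>
    simp only [List.flatMap_cons, insertLeft_append_iff, ih]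
    constructor
    · rintro ⟨_, _, rfl, hp, d, hd, rfl⟩
      obtain ⟨x', rfl, -⟩ := hp.exists_of_cycleWord
      exact ⟨(x', p.2) :: d, .cons hp hd, rfl⟩
    · rintro ⟨_, hpd, rfl⟩
      obtain ⟨q, d, hq, hd, rfl⟩ := List.forall₂_cons_left_iff.1 hpd
      exact ⟨_, _, rfl, hq, d, hd, rfl⟩

theorem InsertCycles.eq_of_flatMap_eq {d' : List (List ℕ × ℕ)} (ha : a ∉ c.flatMap cycleWord)
    (h : InsertCycles a c d) (h' : InsertCycles a c d')
    (heq : d.flatMap cycleWord = d'.flatMap cycleWord) : d = d' := by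
  induction h generalizing d' with
  | nil => exact (List.forall₂_nil_left_iff.1 h').symm
  | @cons p q c d hq _ ih =>
    obtain ⟨q', d', hq', hd', rfl⟩ := List.forall₂_cons_left_iff.1 h'
    rw [List.flatMap_cons, List.mem_append, not_or] at ha
    rw [List.flatMap_cons, List.flatMap_cons] at heq
    obtain rfl := cycleWord_injective (hq.eq_of_append_eq_append ha.1 hq' heq)
    rw [ih ha.2 hd' (List.append_cancel_left heq)]

/-- The lists of cycles that arise from `c` by inserting `m` copies of `a` to the left of letters
in the cycles of `c`. -/
def cycleInsertions (a : ℕ) (c : List (List ℕ × ℕ)) (m : ℕ) : Set (List (List ℕ × ℕ)) :=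
  {d | InsertCycles a c d ∧ (d.flatMap cycleWord).count a = m}

theorem encard_cycleInsertions (ha : a ∉ c.flatMap cycleWord) (m : ℕ) :
    (cycleInsertions a c m).encard = (c.flatMap cycleWord).length.multichoose m := by
  have hinj : Set.InjOn (List.flatMap cycleWord) (cycleInsertions a c m) :=
    fun d hd d' hd' => hd.1.eq_of_flatMap_eq ha hd'.1
  have himage : List.flatMap cycleWord '' cycleInsertions a c m =
      wordInsertions a (c.flatMap cycleWord) m := by
    ext z
    simp only [cycleInsertions, wordInsertions, Set.mem_image, Set.mem_ofPred_eq,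
      insertLeft_flatMap_cycleWord_iff]
    grind
  rw [← hinj.encard_image, himage, encard_wordInsertions ha]

end InsertCycles

section CycleFactorisation

variable {w : List ℕ} {c d : List (List ℕ × ℕ)} {t m k : ℕ}

theorem map_snd_columns (c : List (List ℕ × ℕ)) :
    (columns c).map Prod.snd = c.flatMap cycleWord := by
  simp only [columns, List.map_flatMap, map_snd_path]
  rfl

theorem IsCycleFactorisation.perm (h : IsCycleFactorisation w c) :
    (c.flatMap cycleWord).Perm w := by
  have hperm := ((cycleProd_eq_iff h.lt).1 h.prod_eq).perm.map Prod.snd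
  rwa [map_snd_columns, map_snd_twoLine] at hperm

theorem IsCycleFactorisation.cycles_eq (h : IsCycleFactorisation w c) : cycles w = c :=
  (existsUnique_isCycleFactorisation w).unique (isCycleFactorisation_cycles w) h

theorem cycles_injective : Function.Injective cycles := fun w w' h => by
  rw [← (isCycleFactorisation_cycles w).prod_eq, h, (isCycleFactorisation_cycles w').prod_eq]

theorem flatMap_cycleWord_append_replicate (d : List (List ℕ × ℕ)) (k t : ℕ) :
    (d ++ List.replicate k ([], t)).flatMap cycleWord =
      d.flatMap cycleWord ++ List.replicate k t := by
  induction k with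
  | zero => simp
  | succ k ih => simpa [List.replicate_succ', cycleWord] using ih

theorem IsCycleFactorisation.append_replicate (hw : IsCycleFactorisation w c)
    (hlt : ∀ x ∈ w, x < t) (hd : InsertCycles t c d) (k : ℕ) :
    IsCycleFactorisation (cycleProd (d ++ List.replicate k ([], t)))
      (d ++ List.replicate k ([], t)) := by
  have hlast : ∀ p ∈ c, p.2 < t := fun p hp => hlt _ <| hw.perm.subset <|
    List.mem_flatMap.2 ⟨p, hp, by simp [cycleWord]⟩
  have hdlt : ∀ q ∈ d, ∀ x ∈ q.1, q.2 < x := by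
    intro q hq x hx
    obtain ⟨p, hp, hpq⟩ := hd.exists_of_mem hq
    rw [hpq.snd_eq]
    rcases hpq.mem_fst_or_eq hx with hx | rfl
    exacts [hw.lt p hp x hx, hlast p hp]
  refine ⟨rfl, ?_, ?_⟩
  · rw [List.map_append, hd.map_snd, List.pairwise_append]
    refine ⟨hw.sorted, by simp [List.pairwise_replicate], ?_⟩
    simp only [List.mem_map, List.mem_replicate, List.map_replicate]
    rintro _ ⟨p, hp, rfl⟩ _ ⟨-, rfl⟩
    exact (hlast p hp).le
  · intro q hq
    rcases List.mem_append.1 hq with hq | hq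
    · exact hdlt q hq
    · simp [List.eq_of_mem_replicate hq]

theorem IsExtension.length_eq {c' : List (List ℕ × ℕ)} (h : IsExtension t m k c c') :
    c'.length = c.length + k := by
  obtain ⟨d, hd, rfl, -⟩ := h
  rw [List.length_append, List.length_replicate, hd.length_eq]

theorem setOf_isExtension (hk : k ≤ m) :
    {c' | IsExtension t m k c c'} =
      (· ++ List.replicate k ([], t)) '' cycleInsertions t c (m - k) := by
  ext c'
  simp only [IsExtension, cycleInsertions, Set.mem_ofPred_eq, Set.mem_image]
  constructor
  · rintro ⟨d, hd, rfl, hcount⟩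
    rw [flatMap_cycleWord_append_replicate, List.count_append, List.count_replicate_self] at hcount
    exact ⟨d, ⟨hd, by lia⟩, rfl⟩
  · rintro ⟨d, ⟨hd, hcount⟩, rfl⟩
    refine ⟨d, hd, rfl, ?_⟩
    rw [flatMap_cycleWord_append_replicate, List.count_append, List.count_replicate_self, hcount,
      Nat.sub_add_cancel hk]

end CycleFactorisation

section MultisetPerm

variable {n : ℕ → ℕ} {t k : ℕ}

instance : Finite (MultisetPerm n t) := by
  classical
  refine ((Multiset.lists (∑ i ∈ Finset.Icc 1 t,
    Multiset.replicate (n i) i)).finite_toSet.subset fun w hw => ?_).to_subtype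
  simpa [Multiset.mem_lists_iff] using Eq.symm hw

theorem MultisetPerm.length_eq (w : MultisetPerm n t) : w.1.length = total n t := by
  rw [← Multiset.coe_card, w.2]
  simp [total]

theorem MultisetPerm.lt_succ (w : MultisetPerm n t) {x : ℕ} (hx : x ∈ w.1) : x < t + 1 := by
  rw [← Multiset.mem_coe, w.2, Multiset.mem_sum] at hx
  obtain ⟨i, hi, hxi⟩ := hx
  rw [Multiset.eq_of_mem_replicate hxi]
  exact Nat.lt_succ_of_le (Finset.mem_Icc.1 hi).2

theorem exists_multisetPerm_cycles_eq (w : MultisetPerm n t) {c' : List (List ℕ × ℕ)}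
    (h : IsExtension (t + 1) (n (t + 1)) k (cycles w.1) c') :
    ∃ w' : MultisetPerm n (t + 1), cycles w'.1 = c' := by
  obtain ⟨d, hd, rfl, hcount⟩ := h
  have hperm := (isCycleFactorisation_cycles w.1).perm
  have hfac := (isCycleFactorisation_cycles w.1).append_replicate (fun _ => w.lt_succ) hd k
  refine ⟨⟨cycleProd (d ++ List.replicate k ([], t + 1)), ?_⟩, hfac.cycles_eq⟩
  have hins := (insertLeft_flatMap_cycleWord_iff.2 ⟨d, hd, rfl⟩).perm_append_replicate
    fun h => (w.lt_succ (hperm.subset h)).false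
  rw [flatMap_cycleWord_append_replicate, List.count_append, List.count_replicate_self] at hcount
  have hword : (cycleProd (d ++ List.replicate k ([], t + 1))).Perm
      (w.1 ++ List.replicate (n (t + 1)) (t + 1)) := by
    refine hfac.perm.symm.trans ?_
    rw [flatMap_cycleWord_append_replicate, ← hcount, List.replicate_add, ← List.append_assoc]
    exact (hins.trans (hperm.append_right _)).append_right _
  rw [Multiset.coe_eq_coe.2 hword, Finset.sum_Icc_succ_top (by lia), ← Multiset.coe_add,
    Multiset.coe_replicate, w.2]

theorem encard_setOf_isExtension (w : MultisetPerm n t) (hk : k ≤ n (t + 1)) :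
    {w' : MultisetPerm n (t + 1) |
      IsExtension (t + 1) (n (t + 1)) k (cycles w.1) (cycles w'.1)}.encard =
      (total n t).multichoose (n (t + 1) - k) := by
  have hperm := (isCycleFactorisation_cycles w.1).perm
  have hinj : Function.Injective fun w' : MultisetPerm n (t + 1) => cycles w'.1 :=
    cycles_injective.comp Subtype.val_injective
  have himage : (fun w' : MultisetPerm n (t + 1) => cycles w'.1) ''
      {w' | IsExtension (t + 1) (n (t + 1)) k (cycles w.1) (cycles w'.1)} =
      {c' | IsExtension (t + 1) (n (t + 1)) k (cycles w.1) c'} :=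
    Set.image_preimage_eq_of_subset
      (s := {c' | IsExtension (t + 1) (n (t + 1)) k (cycles w.1) c'})
      fun c' hc' => exists_multisetPerm_cycles_eq w hc'
  rw [← hinj.encard_image, himage, setOf_isExtension hk,
    (List.append_left_injective _).encard_image,
    encard_cycleInsertions fun h => (w.lt_succ (hperm.subset h)).false,
    hperm.length_eq, w.length_eq]

theorem numCycles_of_isExtension {m : ℕ} {w w' : List ℕ}
    (h : IsExtension t m k (cycles w) (cycles w')) : numCycles w' = numCycles w + k :=
  h.length_eq

end MultisetPerm

end MultisetCRP

section Independence

variable {Ω : Type*} [MeasurableSpace Ω] {P : Measure Ω}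

theorem map_prodMk_eq_prod_of_measure_fiber [IsFiniteMeasure P] {ι E : Type*} [MeasurableSpace ι]
    [Countable ι] [MeasurableSingletonClass ι] [MeasurableSpace E] {X : Ω → ι} {Y : Ω → E}
    (hX : Measurable X) (hY : Measurable Y) {ν : Measure E} [SigmaFinite ν]
    (h : ∀ x B, MeasurableSet B → P (X ⁻¹' {x} ∩ Y ⁻¹' B) = P (X ⁻¹' {x}) * ν B) :
    P.map (fun ω => (X ω, Y ω)) = (P.map X).prod ν := by
  refine (Measure.prod_eq fun A B hA hB => ?_).symm
  have hrestrict : (P.restrict (Y ⁻¹' B)).map X = ν B • P.map X := by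
    refine Measure.ext_of_singleton fun x => ?_
    have hx := measurableSet_singleton x
    rw [Measure.map_apply hX hx, Measure.restrict_apply (hX hx), h x B hB, Measure.smul_apply,
      Measure.map_apply hX hx, smul_eq_mul, mul_comm]
  rw [Measure.map_apply (hX.prodMk hY) (hA.prod hB), Set.mk_preimage_prod,
    ← Measure.restrict_apply (hX hA), ← Measure.map_apply hX hA, hrestrict, Measure.smul_apply,
    smul_eq_mul, mul_comm]

theorem iIndepFun_of_indepFun_Iio [IsProbabilityMeasure P] {ι : Type*} [LinearOrder ι]
    {β : ι → Type*} [∀ i, MeasurableSpace (β i)] {X : (i : ι) → Ω → β i}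
    (h : ∀ i, IndepFun (fun ω (j : Set.Iio i) => X j ω) (X i) P) : iIndepFun X P := by
  rw [iIndepFun_iff_measure_inter_preimage_eq_mul]
  intro S B hB
  induction S using Finset.induction_on_max with
  | empty => simp
  | insert i S hi ih =>
    have hB' (j) (hj : j ∈ S) := hB j (Finset.mem_insert_of_mem hj)
    have hpast : ⋂ j ∈ S, X j ⁻¹' B j = (fun ω (j : Set.Iio i) => X j ω) ⁻¹'
        ⋂ j : S, (fun x => x ⟨j, hi j j.2⟩) ⁻¹' B j := by
      ext ω
      simp
    have hmeas : MeasurableSet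
        (⋂ j : S, (fun x : (j : Set.Iio i) → β j => x ⟨j, hi j j.2⟩) ⁻¹' B j) :=
      .iInter fun j => measurable_pi_apply _ (hB' j j.2)
    rw [Finset.set_biInter_insert, Finset.prod_insert fun his => (hi i his).false, Set.inter_comm,
      ← ih hB', hpast, (h i).measure_inter_preimage_eq_mul _ _ hmeas
        (hB i (Finset.mem_insert_self i S)), mul_comm]

end Independence

namespace MultisetCRP

variable {n : ℕ → ℕ} {t : ℕ}

section Transitions

theorem weight_one_succ (n : ℕ → ℕ) (t : ℕ) :
    weight n 1 (t + 1) = (total n t + 1).multichoose (n (t + 1)) := by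
  simp only [weight, one_pow, mul_one, Nat.add_sub_cancel]
  exact_mod_cast sum_multichoose (total n t) (n (t + 1))

theorem numCycles_zero (w : MultisetPerm n 0) : numCycles w.1 = 0 := by
  have hw : w.1 = [] := List.length_eq_zero_iff.1 (by simp [w.length_eq, total])
  have hperm := (isCycleFactorisation_cycles w.1).perm
  rw [hw, List.perm_nil, List.flatMap_eq_nil_iff] at hperm
  rw [numCycles, hw, List.length_eq_zero_iff, List.eq_nil_iff_forall_not_mem]
  intro p hp
  simpa [cycleWord] using hperm p hp

theorem sum_transProb_one_mul [Fintype (MultisetPerm n (t + 1))] (w : MultisetPerm n t)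
    (f : ℝ → ℝ) :
    ∑ v : MultisetPerm n (t + 1), transProb n 1 (t + 1) w.1 v.1 *
      f (numCycles v.1 - numCycles w.1) = ∫ x, f x ∂boseEinstein (total n t) (n (t + 1)) := by
  classical
  rw [integral_boseEinstein]
  simp only [transProb, Finset.sum_mul, one_pow]
  rw [Finset.sum_comm]
  refine Finset.sum_congr rfl fun k hk => ?_
  have hcard := encard_setOf_isExtension w (Nat.lt_succ_iff.1 (Finset.mem_range.1 hk))
  rw [← Finset.coe_filter_univ, Set.encard_coe_eq_coe_finsetCard, ENat.natCast_inj] at hcard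
  have hterm (v : MultisetPerm n (t + 1)) :
      (if IsExtension (t + 1) (n (t + 1)) k (cycles w.1) (cycles v.1) then
        1 / weight n 1 (t + 1) else 0) * f (numCycles v.1 - numCycles w.1) =
      if IsExtension (t + 1) (n (t + 1)) k (cycles w.1) (cycles v.1) then
        1 / weight n 1 (t + 1) * f k else 0 := by
    split_ifs with h
    · rw [numCycles_of_isExtension h, Nat.cast_add, add_sub_cancel_left]
    · rw [zero_mul]
  rw [Finset.sum_congr rfl fun v _ => hterm v, ← Finset.sum_filter, Finset.sum_const, hcard,
    weight_one_succ, nsmul_eq_mul]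
  simp only [boseEinsteinWeight, NNReal.coe_div, NNReal.coe_natCast]
  ring

end Transitions

section MarkovChain

variable {Ω : Type*} {π : (t : ℕ) → Ω → MultisetPerm n t}

instance : MeasurableSpace (MultisetPerm n t) := ⊤

instance : DiscreteMeasurableSpace (MultisetPerm n t) := ⟨fun _ => trivial⟩

/-- The number of cycles created in step `t + 1` of the process; we index it by `t`. -/
noncomputable def newCycles (π : (t : ℕ) → Ω → MultisetPerm n t) (t : ℕ) (ω : Ω) : ℝ :=
  cycleCount π (t + 1) ω - cycleCount π t ω

/-- The path of the process up to time `t`, on which the new cycles of step `t + 1` do not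
depend. -/
def pathUpTo (π : (t : ℕ) → Ω → MultisetPerm n t) (t : ℕ) (ω : Ω) (s : Set.Iic t) :
    MultisetPerm n s :=
  π s ω

theorem cycleCount_eq_sum_newCycles (π : (t : ℕ) → Ω → MultisetPerm n t) :
    cycleCount π = fun t ω => ∑ s ∈ Finset.range t, newCycles π s ω := by
  ext t ω
  have hzero : cycleCount π 0 ω = 0 := by simp [cycleCount, numCycles_zero]
  simp only [newCycles]
  rw [Finset.sum_range_sub (fun t => cycleCount π t ω), hzero, sub_zero]

variable [MeasurableSpace Ω] {P : Measure Ω} {θ : ℝ}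

theorem IsMultisetCRP.measurable (hπ : IsMultisetCRP P n θ π) (t : ℕ) : Measurable (π t) :=
  measurable_to_countable' (hπ.measurableSet_eq t)

theorem IsMultisetCRP.measurable_pathUpTo (hπ : IsMultisetCRP P n θ π) (t : ℕ) :
    Measurable (pathUpTo π t) :=
  measurable_pi_lambda _ fun s => hπ.measurable s

theorem IsMultisetCRP.measurable_newCycles (hπ : IsMultisetCRP P n θ π) (t : ℕ) :
    Measurable (newCycles π t) :=
  have hcount (s : ℕ) : Measurable (cycleCount π s) :=
    (Measurable.of_discrete (f := fun w : MultisetPerm n s => (numCycles w.1 : ℝ))).comp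
      (hπ.measurable s)
  (hcount (t + 1)).sub (hcount t)

theorem IsMultisetCRP.measureReal_inter_eq_mul_transProb (hπ : IsMultisetCRP P n θ π) (t : ℕ)
    (w : (s : ℕ) → MultisetPerm n s) (v : MultisetPerm n (t + 1)) :
    P.real ({ω | ∀ s ≤ t, π s ω = w s} ∩ π (t + 1) ⁻¹' {v}) =
      P.real {ω | ∀ s ≤ t, π s ω = w s} * transProb n θ (t + 1) (w t).1 v.1 := by
  have hpath : {ω | ∀ s ≤ t, π s ω = w s} ∩ π (t + 1) ⁻¹' {v} =
      {ω | ∀ s ≤ t + 1, π s ω = Function.update w (t + 1) v s} := by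
    ext ω
    simp only [Nat.le_succ_iff, or_imp, forall_and, forall_eq, Function.update_self]
    refine and_congr_left fun _ => forall₂_congr fun s hs => ?_
    rw [Function.update_of_ne (by lia)]
  rw [hpath, hπ.law, hπ.law, Finset.prod_range_succ, Function.update_self,
    Function.update_of_ne (by lia)]
  congr 1
  refine Finset.prod_congr rfl fun s hs => ?_
  rw [Finset.mem_range] at hs
  rw [Function.update_of_ne (by lia), Function.update_of_ne (by lia)]

variable [IsProbabilityMeasure P]

theorem IsMultisetCRP.measureReal_inter_newCycles (hπ : IsMultisetCRP P n 1 π) (t : ℕ)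
    (w : (s : ℕ) → MultisetPerm n s) {B : Set ℝ} (hB : MeasurableSet B) :
    P.real ({ω | ∀ s ≤ t, π s ω = w s} ∩ newCycles π t ⁻¹' B) =
      P.real {ω | ∀ s ≤ t, π s ω = w s} *
        (boseEinstein (total n t) (n (t + 1))).real B := by
  classical
  have := Fintype.ofFinite (MultisetPerm n (t + 1))
  have hcover : {ω | ∀ s ≤ t, π s ω = w s} ∩ newCycles π t ⁻¹' B =
      ⋃ v ∈ ({v | (numCycles v.1 - numCycles (w t).1 : ℝ) ∈ B} : Finset (MultisetPerm n (t + 1))),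
        {ω | ∀ s ≤ t, π s ω = w s} ∩ π (t + 1) ⁻¹' {v} := by
    ext ω
    simp only [newCycles, cycleCount, Set.mem_inter_iff, Set.mem_preimage, Set.mem_iUnion]
    simp only [Set.mem_ofPred_eq, Set.mem_singleton_iff, Finset.mem_filter_univ, exists_and_left,
      exists_prop, ↓existsAndEq, and_true, and_congr_right_iff]
    intro hω
    rw [hω t le_rfl]
  have hmeas : MeasurableSet {ω | ∀ s ≤ t, π s ω = w s} := by
    simp only [Set.ofPred_forall]
    exact .iInter fun s => .iInter fun _ => hπ.measurableSet_eq s (w s)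
  have hdisj (V : Set (MultisetPerm n (t + 1))) : V.PairwiseDisjoint fun v =>
      {ω | ∀ s ≤ t, π s ω = w s} ∩ π (t + 1) ⁻¹' {v} :=
    fun v _ v' _ hne => (pairwise_disjoint_fiber (π (t + 1)) hne).mono
      Set.inter_subset_right Set.inter_subset_right
  rw [hcover, measureReal_biUnion_finset (hdisj _) fun v _ => hmeas.inter
    (hπ.measurable (t + 1) (measurableSet_singleton v)), ← integral_indicator_one hB,
    ← sum_transProb_one_mul (w t), Finset.mul_sum, Finset.sum_filter]
  refine Finset.sum_congr rfl fun v _ => ?_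
  rw [hπ.measureReal_inter_eq_mul_transProb, Set.indicator_apply]
  split_ifs <;> simp

theorem IsMultisetCRP.map_pathUpTo_prodMk_newCycles (hπ : IsMultisetCRP P n 1 π) (t : ℕ) :
    P.map (fun ω => (pathUpTo π t ω, newCycles π t ω)) =
      (P.map (pathUpTo π t)).prod (boseEinstein (total n t) (n (t + 1))) := by
  refine map_prodMk_eq_prod_of_measure_fiber (hπ.measurable_pathUpTo t)
    (hπ.measurable_newCycles t) fun x B hB => ?_
  rcases (pathUpTo π t ⁻¹' {x}).eq_empty_or_nonempty with hx | ⟨ω₀, rfl⟩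
  · rw [hx, Set.empty_inter, measure_empty, zero_mul]
  · have hfiber : pathUpTo π t ⁻¹' {pathUpTo π t ω₀} = {ω | ∀ s ≤ t, π s ω = π s ω₀} := by
      ext ω
      simp [pathUpTo, funext_iff]
    rw [hfiber, ← ENNReal.toReal_eq_toReal_iff' (by finiteness) (by finiteness),
      ENNReal.toReal_mul]
    exact hπ.measureReal_inter_newCycles t (fun s => π s ω₀) hB

theorem IsMultisetCRP.hasLaw_newCycles (hπ : IsMultisetCRP P n 1 π) (t : ℕ) :
    HasLaw (newCycles π t) (boseEinstein (total n t) (n (t + 1))) P where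
  aemeasurable := (hπ.measurable_newCycles t).aemeasurable
  map_eq := by
    have hpath := hπ.measurable_pathUpTo t
    have := Measure.isProbabilityMeasure_map (μ := P) hpath.aemeasurable
    rw [← Measure.snd_map_prodMk (Y := newCycles π t) hpath, hπ.map_pathUpTo_prodMk_newCycles t,
      Measure.snd_prod]

theorem IsMultisetCRP.iIndepFun_newCycles (hπ : IsMultisetCRP P n 1 π) :
    iIndepFun (newCycles π) P := by
  refine iIndepFun_of_indepFun_Iio fun t => ?_
  have hindep : IndepFun (pathUpTo π t) (newCycles π t) P := by
    rw [indepFun_iff_map_prod_eq_prod_map_map (hπ.measurable_pathUpTo t).aemeasurable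
      (hπ.measurable_newCycles t).aemeasurable, (hπ.hasLaw_newCycles t).map_eq,
      hπ.map_pathUpTo_prodMk_newCycles]
  let increments (x : (s : Set.Iic t) → MultisetPerm n s) (s : Set.Iio t) : ℝ :=
    numCycles (x ⟨s + 1, Set.mem_Iic.2 s.2⟩).1 - numCycles (x ⟨s, Set.mem_Iic.2 (le_of_lt s.2)⟩).1
  exact hindep.comp (φ := increments) .of_discrete measurable_id

end MarkovChain

section Growth

-- The term `s = 0` on the right divides by `total n 0 = 0`, so it is `0` in Lean.
theorem sum_Icc_two_div_total (n : ℕ → ℕ) (T : ℕ) :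
    ∑ t ∈ Finset.Icc 2 T, (n t : ℝ) / total n (t - 1) =
      ∑ s ∈ Finset.range T, (n (s + 1) : ℝ) / total n s := by
  induction T with
  | zero => simp
  | succ T ih =>
    rw [Finset.sum_range_succ]
    rcases Nat.eq_zero_or_pos T with rfl | hT
    · simp [total]
    · rw [Finset.sum_Icc_succ_top (by lia), ih, Nat.add_sub_cancel]

theorem div_total_add_one_le {C : ℝ} (hC : ∀ t, 2 ≤ t → (n t : ℝ) ≤ C * total n (t - 1))
    (s : ℕ) : (n (s + 1) : ℝ) / (total n s + 1) ≤ max C (n 1) := by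
  rcases Nat.eq_zero_or_pos s with rfl | hs
  · simp [total]
  · rw [div_le_iff₀ (by positivity)]
    calc (n (s + 1) : ℝ) ≤ C * total n s := hC (s + 1) (by lia)
      _ ≤ max C (n 1) * (total n s + 1) := by
        gcongr
        · exact le_max_left ..
        · exact le_add_of_nonneg_right zero_le_one

end Growth

end MultisetCRP

open MultisetCRP in
theorem theorem4 {Ω : Type*} [MeasurableSpace Ω] (P : Measure Ω) [IsProbabilityMeasure P]
    (n : ℕ → ℕ) (hn : ∀ t, 1 ≤ t → 1 ≤ n t)
    (hO : ∃ C : ℝ, ∀ t, 2 ≤ t → (n t : ℝ) ≤ C * (MultisetCRP.total n (t - 1) : ℝ))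
    (hsum : Tendsto (fun T : ℕ => ∑ t ∈ Finset.Icc 2 T,
      (n t : ℝ) / (MultisetCRP.total n (t - 1) : ℝ)) atTop atTop)
    (π : (t : ℕ) → Ω → MultisetCRP.MultisetPerm n t)
    (hπ : MultisetCRP.IsMultisetCRP P n 1 π) :
    (∀ᵐ ω ∂P, Tendsto (fun t : ℕ =>
      MultisetCRP.cycleCount π t ω / ∫ ω', MultisetCRP.cycleCount π t ω' ∂P) atTop (𝓝 1)) ∧
    TendstoInDistribution (fun (t : ℕ) ω =>
        (MultisetCRP.cycleCount π t ω - ∫ ω', MultisetCRP.cycleCount π t ω' ∂P) /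
          √(variance (MultisetCRP.cycleCount π t) P))
      atTop id (fun _ => P) (gaussianReal 0 1) := by
  obtain ⟨C, hC⟩ := hO
  simp only [sum_Icc_two_div_total] at hsum
  have hind := hπ.iIndepFun_newCycles
  have hlaw := hπ.hasLaw_newCycles
  have hbound := div_total_add_one_le hC
  rw [cycleCount_eq_sum_newCycles]
  exact ⟨ae_tendsto_sum_div_integral_of_hasLaw_boseEinstein hind hlaw hbound hsum,
    tendstoInDistribution_sum_of_hasLaw_boseEinstein hind hlaw hbound hsum⟩
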